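/- Let $Spec$ be a sequential specification, i.e. the set of finite traces of a labelled transition system (LTS) whose labels are operations $m(a)\Rightarrow b$ (method $m$, argument $a$, return value $b$). Assume that $Spec$ is deterministic and non-blocking: from each state of this LTS and for all $m,a$ there is exactly one transition with a label of the form $m(a)\Rightarrow\cdot$. For a concurrent object $\mathcal O$ and a number $n$ of processes, $\llbracket\mathcal O,n\rrbracket$ is the LTS of $n$ processes, each of which repeatedly calls an arbitrary method of $\mathcal O$ with an arbitrary argument, executes the (always executable) atomic commands of the method on its local state and the shared memory, and returns; its labels are call actions, return actions and internal actions of the processes, and calls and returns do not change the shared memory. Let $\mathcal A_{Spec}$ be the classical wait-free universal construction of Herlihy for $Spec$ and $n$ processes: each operation announces a node, nodes are appended to a linked list through one consensus object per node with helping of announced operations, and an operation whose node is in the list computes its return value by replaying the list up to its node on a private copy of the sequential object. $\mathcal O$ is linearizable w.r.t. $Spec$ for $n$ processes if the history $h$ (projection to calls and returns) of every finite trace of $\llbracket\mathcal O,n\rrbracket$ has an extension $h'$ by return actions such that the completion of $h'$ (remove pending calls) is equivalent to a sequential history $s$ of $Spec$, and $s$ preserves the happen-before order of $h$ between the operations of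 the completion. For an infinite trace $t$ let $sched(t)$ say that if some call never returns in $t$, then some process with a call that never returns takes infinitely many steps. $\mathcal O$ is wait-free for $n$ processes if in every infinite trace $t$ of $\llbracket\mathcal O,n\rrbracket$ with $sched(t)$ every call returns; lock-free if in every such $t$ each time at which some call is pending is followed by a return action; obstruction-free if every call returns in every such $t$ in which eventually only one process takes steps. Write $A_1\preceq_{(c,r)}A_2$ if there is a relation $R$ between the states of $A_1$ and of $A_2$ that relates the initial states and such that, whenever $(c_1,c_2)\in R$ and $c_1\xrightarrow{\alpha}c_1'$ in $A_1$, some finite transition sequence of $A_2$ with label sequence $l$ leads from $c_2$ to a state $c_2'$ with $(c_1',c_2')\in R$, where $\alpha$ and $l$ have the same projection to call and return actions. Then: if $\mathcal O$ is linearizable w.r.t. $Spec$ for $n$ processes and wait-free (resp. lock-free, obstruction-free) for $n$ processes, then $$\llbracket \mathcal A_{Spec},n\rrbracket \preceq_{(c,r)} \llbracket \mathcal O,n\rrbracket .$$ -/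

import Mathlib

/-! ### Labelled transition systems -/

/-- A labelled transition system `(Q, Σ, →, q₀)` over the alphabet `Lab`. -/
structure LTS (Lab : Type*) where
  State : Type*
  init : State
  trans : State → Lab → State → Prop

/-- `A.Run q l q'`: there is a finite transition sequence from `q` to `q'` labelled by `l`. -/
inductive LTS.Run {Lab : Type*} (A : LTS Lab) : A.State → List Lab → A.State → Prop
  | nil (q : A.State) : LTS.Run A q [] q
  | cons {q q₁ q' : A.State} {x : Lab} {l : List Lab} :
      A.trans q x q₁ → LTS.Run A q₁ l q' → LTS.Run A q (x :: l) q'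

/-- Finite traces (label sequences of finite paths from the initial state). -/
def LTS.FiniteTrace {Lab : Type*} (A : LTS Lab) (l : List Lab) : Prop :=
  ∃ q, A.Run A.init l q

/-- Infinite traces (label sequences of infinite paths from the initial state). -/
def LTS.InfiniteTrace {Lab : Type*} (A : LTS Lab) (t : ℕ → Lab) : Prop :=
  ∃ s : ℕ → A.State, s 0 = A.init ∧ ∀ i, A.trans (s i) (t i) (s (i + 1))

/-! ### Sequential specifications -/

/-- An operation `m(a) ⇒ b`. -/
structure Op (M A B : Type*) where
  meth : M
  arg : A
  res : B

/-- A sequential specification is presented by an LTS whose labels are operations; as a set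
of operation sequences it is the (prefix-closed) set of finite traces of this LTS. -/
abbrev SeqLTS (M A B : Type*) := LTS (Op M A B)

def SeqLTS.spec {M A B : Type*} (S : SeqLTS M A B) : Set (List (Op M A B)) :=
  {l | LTS.FiniteTrace S l}

/-- From each state, at most one transition with a label of the form `m(a) ⇒ ·`. -/
def SeqLTS.Deterministic {M A B : Type*} (S : SeqLTS M A B) : Prop :=
  ∀ (q : S.State) (m : M) (a : A) (b₁ b₂ : B) (q₁ q₂ : S.State),
    S.trans q ⟨m, a, b₁⟩ q₁ → S.trans q ⟨m, a, b₂⟩ q₂ → b₁ = b₂ ∧ q₁ = q₂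

/-- From each state, at least one transition with a label of the form `m(a) ⇒ ·`. -/
def SeqLTS.NonBlocking {M A B : Type*} (S : SeqLTS M A B) : Prop :=
  ∀ (q : S.State) (m : M) (a : A), ∃ (b : B) (q' : S.State), S.trans q ⟨m, a, b⟩ q'

/-! ### Histories and linearizability -/

/-- Call and return actions of `n` processes. -/
inductive HAction (M A B : Type*) (n : ℕ)
  | call (p : Fin n) (m : M) (a : A)
  | ret (p : Fin n) (m : M) (b : B)

namespace HAction

variable {M A B : Type*} {n : ℕ}

/-- The process that performs the action. -/
def pid : HAction M A B n → Fin n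
  | call p _ _ => p
  | ret p _ _ => p

def isCall : HAction M A B n → Bool
  | call _ _ _ => true
  | ret _ _ _ => false

def isRet (e : HAction M A B n) : Bool := !e.isCall

end HAction

namespace History

variable {M A B : Type*} {n : ℕ}

/-- The process subhistory `h|ₚ`. -/
def proj (h : List (HAction M A B n)) (p : Fin n) : List (HAction M A B n) :=
  h.filter (fun e => decide (e.pid = p))

/-- Sequential histories: start with a call, each call is immediately followed by a matching
return and each return by a call, except possibly for the last action. -/
def IsSequential : List (HAction M A B n) → Prop
  | [] => True
  | [HAction.call _ _ _] => True
  | HAction.call p m _ :: HAction.ret q m' _ :: t => p = q ∧ m = m' ∧ IsSequential t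
  | _ => False

/-- Well-formed histories: every process subhistory is sequential. -/
def WellFormed (h : List (HAction M A B n)) : Prop := ∀ p, IsSequential (proj h p)

/-- Equivalent histories have the same process subhistories. -/
def Equivalent (h h' : List (HAction M A B n)) : Prop := ∀ p, proj h p = proj h' p

open Classical in
/-- `complete h` keeps the matched calls and returns of a well-formed `h`, that is, it drops
the pending calls (the calls with no later return of the same process). -/
noncomputable def complete : List (HAction M A B n) → List (HAction M A B n)
  | [] => []
  | HAction.call p m a :: t =>
      if ∃ m' b, HAction.ret p m' b ∈ t then HAction.call p m a :: complete t else complete t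
  | HAction.ret p m b :: t => HAction.ret p m b :: complete t

/-- Position `i` of `h` is the call of the `k`-th operation (from `0`) of process `p`, where
`o = (p, k)`. Operations are identified by their process and their rank in its subhistory. -/
def InvAt (h : List (HAction M A B n)) (o : Fin n × ℕ) (i : ℕ) : Prop :=
  (∃ e, h[i]? = some e ∧ e.pid = o.1 ∧ e.isCall = true) ∧
    (proj (h.take i) o.1).countP (fun e => e.isCall) = o.2

/-- Position `i` of `h` is the return of operation `o = (p, k)`. -/
def ResAt (h : List (HAction M A B n)) (o : Fin n × ℕ) (i : ℕ) : Prop :=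
  (∃ e, h[i]? = some e ∧ e.pid = o.1 ∧ e.isRet = true) ∧
    (proj (h.take i) o.1).countP (fun e => e.isRet) = o.2

/-- `o` is an operation (a call with its matching return) of the well-formed history `h`. -/
def HasOp (h : List (HAction M A B n)) (o : Fin n × ℕ) : Prop := ∃ i, ResAt h o i

/-- The happen-before relation `o₁ <ₕ o₂`: `res(o₁)` occurs before `inv(o₂)` in `h`. -/
def HappensBefore (h : List (HAction M A B n)) (o₁ o₂ : Fin n × ℕ) : Prop :=
  ∃ i j, i < j ∧ ResAt h o₁ i ∧ InvAt h o₂ j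

/-- The sequential histories of `n` processes that correspond to `Spec`. -/
def toHistory (Spec : Set (List (Op M A B))) (n : ℕ) : Set (List (HAction M A B n)) :=
  {s | ∃ l : List (Fin n × Op M A B), l.map Prod.snd ∈ Spec ∧
    s = l.flatMap (fun x =>
      [HAction.call x.1 x.2.meth x.2.arg, HAction.ret x.1 x.2.meth x.2.res])}

/-- Linearizability of a history: some extension `h ++ r` by return actions has a completion
that is equivalent to a sequential history `s` of `Spec`, and `s` respects the happen-before
order of `h` between the (completed) operations. -/
def Linearizable (Spec : Set (List (Op M A B))) (h : List (HAction M A B n)) : Prop :=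
  ∃ r : List (HAction M A B n), (∀ e ∈ r, e.isRet = true) ∧ WellFormed (h ++ r) ∧
    ∃ s ∈ toHistory Spec n, Equivalent (complete (h ++ r)) s ∧
      ∀ o₁ o₂, HasOp (h ++ r) o₁ → HasOp (h ++ r) o₂ →
        HappensBefore h o₁ o₂ → HappensBefore s o₁ o₂

end History

/-! ### Concurrent systems -/

/-- Transition labels of a concurrent system: visible call and return actions, and internal
actions of a process. -/
inductive Label (M A B : Type*) (n : ℕ)
  | vis (e : HAction M A B n)
  | tau (p : Fin n)

namespace Label

variable {M A B : Type*} {n : ℕ}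

/-- The process that performs the step. -/
def pid : Label M A B n → Fin n
  | vis e => e.pid
  | tau p => p

def IsCallOf (p : Fin n) (x : Label M A B n) : Prop := ∃ m a, x = vis (HAction.call p m a)

def IsRetOf (p : Fin n) (x : Label M A B n) : Prop := ∃ m b, x = vis (HAction.ret p m b)

def action? : Label M A B n → Option (HAction M A B n)
  | vis e => some e
  | tau _ => none

end Label

/-- The projection of a finite trace to call and return actions. -/
def history {M A B : Type*} {n : ℕ} (l : List (Label M A B n)) : List (HAction M A B n) :=
  l.filterMap Label.action?

/-- A concurrent object for `n` processes: a shared memory and, for each process, the code of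
the methods, given as a transition system over local states (program counter and registers of
the running method). `entry p m a` is the local state in which process `p` starts to execute
method `m` with argument `a`; `step` executes one atomic command, possibly nondeterministic;
`result l = some b` says that in `l` the next command is `return b`. Data that a process keeps
between its method calls is part of the memory. Commands are always executable (waiting is
done by looping), which is `step_total`. -/
structure ConcObj (M A B : Type*) (n : ℕ) where
  Mem : Type*
  Loc : Type*
  initMem : Mem
  entry : Fin n → M → A → Loc
  result : Loc → Option B
  step : Fin n → Loc → Mem → Loc → Mem → Prop
  step_total : ∀ p l μ, result l = none → ∃ l' μ', step p l μ l' μ'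

/-- Control state of a process that runs the most general client: outside of the object, or
executing method `m` in local state `l`. -/
inductive ProcState (M L : Type*)
  | idle
  | busy (m : M) (l : L)

namespace ConcObj

variable {M A B : Type*} {n : ℕ}

/-- Configurations of the concurrent system. -/
structure Config (O : ConcObj M A B n) where
  proc : Fin n → ProcState M O.Loc
  mem : O.Mem

/-- Steps of the concurrent system. The most general client of an idle process calls an
arbitrary method with an arbitrary argument. Calls and returns do not touch the memory. -/
inductive Trans (O : ConcObj M A B n) : O.Config → Label M A B n → O.Config → Prop
  | call (c : O.Config) (p : Fin n) (m : M) (a : A) (hp : c.proc p = ProcState.idle) :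
      Trans O c (Label.vis (HAction.call p m a))
        ⟨Function.update c.proc p (ProcState.busy m (O.entry p m a)), c.mem⟩
  | internal (c : O.Config) (p : Fin n) (m : M) (l l' : O.Loc) (μ' : O.Mem)
      (hp : c.proc p = ProcState.busy m l) (hl : O.result l = none)
      (hs : O.step p l c.mem l' μ') :
      Trans O c (Label.tau p) ⟨Function.update c.proc p (ProcState.busy m l'), μ'⟩
  | ret (c : O.Config) (p : Fin n) (m : M) (l : O.Loc) (b : B)
      (hp : c.proc p = ProcState.busy m l) (hl : O.result l = some b) :
      Trans O c (Label.vis (HAction.ret p m b))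
        ⟨Function.update c.proc p ProcState.idle, c.mem⟩

/-- The operational semantics `⟦O, n⟧`: `n` processes, each running a most general client. -/
def sem (O : ConcObj M A B n) : LTS (Label M A B n) where
  State := O.Config
  init := ⟨fun _ => ProcState.idle, O.initMem⟩
  trans := O.Trans

/-- `O` is linearizable with respect to `Spec` for `n` processes. -/
def LinearizableWrt (O : ConcObj M A B n) (Spec : Set (List (Op M A B))) : Prop :=
  ∀ l, O.sem.FiniteTrace l → History.Linearizable Spec (history l)

end ConcObj

/-! ### Progress conditions, as predicates on infinite traces -/

namespace Progress

variable {M A B : Type*} {n : ℕ}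

/-- After the first `i` steps of `t`, process `p` has a call with no matching return. -/
def PendingAt (t : ℕ → Label M A B n) (p : Fin n) (i : ℕ) : Prop :=
  ∃ k < i, (t k).IsCallOf p ∧ ∀ j, k < j → j < i → ¬ (t j).IsRetOf p

/-- Process `p` has a call that never returns in `t`. -/
def PendingForever (t : ℕ → Label M A B n) (p : Fin n) : Prop :=
  ∃ k, (t k).IsCallOf p ∧ ∀ j, k < j → ¬ (t j).IsRetOf p

/-- If some call never returns, then some process with a call that never returns is scheduled
infinitely often. -/
def Sched (t : ℕ → Label M A B n) : Prop :=
  (∃ p, PendingForever t p) → ∃ p, PendingForever t p ∧ ∀ i, ∃ j, i ≤ j ∧ (t j).pid = p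

/-- Eventually only one process is scheduled. -/
def Iso (t : ℕ → Label M A B n) : Prop :=
  ∃ (p : Fin n) (i : ℕ), ∀ j, i ≤ j → (t j).pid = p

/-- Every call returns. -/
def ProgT (t : ℕ → Label M A B n) : Prop :=
  ∀ p i, PendingAt t p i → ∃ j, i ≤ j ∧ (t j).IsRetOf p

/-- Whenever some call is pending, some call returns later. -/
def ProgS (t : ℕ → Label M A B n) : Prop :=
  ∀ p i, PendingAt t p i → ∃ j q, i ≤ j ∧ (t j).IsRetOf q

end Progress

namespace ConcObj

variable {M A B : Type*} {n : ℕ}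

def WaitFree (O : ConcObj M A B n) : Prop :=
  ∀ t, O.sem.InfiniteTrace t → Progress.Sched t → Progress.ProgT t

def LockFree (O : ConcObj M A B n) : Prop :=
  ∀ t, O.sem.InfiniteTrace t → Progress.Sched t → Progress.ProgS t

def ObstructionFree (O : ConcObj M A B n) : Prop :=
  ∀ t, O.sem.InfiniteTrace t → Progress.Sched t → Progress.Iso t → Progress.ProgT t

end ConcObj

/-! ### Forward simulation -/

/-- `R` is a forward simulation relation from `A₁` to `A₂`, with call and return actions
visible and all other actions internal. -/
structure IsForwardSimulation {M A B : Type*} {n : ℕ} (A₁ A₂ : LTS (Label M A B n))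
    (R : A₁.State → A₂.State → Prop) : Prop where
  init : R A₁.init A₂.init
  step : ∀ c₁ c₂ x c₁', R c₁ c₂ → A₁.trans c₁ x c₁' →
    ∃ l c₂', A₂.Run c₂ l c₂' ∧ history l = history [x] ∧ R c₁' c₂'

/-- `A₁ ⪯₍c,r₎ A₂`. -/
def ForwardSimulated {M A B : Type*} {n : ℕ} (A₁ A₂ : LTS (Label M A B n)) : Prop :=
  ∃ R : A₁.State → A₂.State → Prop, IsForwardSimulation A₁ A₂ R

/-! ### The classical wait-free universal construction

Nodes are referred to by their address in `ℕ`; address `0` is the sentinel `tail`. The code of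
`apply(m, a)` run by process `i` is

    announce[i] := new Node(m, a)
    head[i] := Node.max(head)
    while announce[i].seq = 0 do
      before := head[i]
      help := announce[(before.seq + 1) % n]
      if help.seq = 0 then prefer := help else prefer := announce[i]
      after := before.decideNext.decide(prefer)
      before.next := after
      after.seq := before.seq + 1
      head[i] := after
    head[i] := announce[i]
    replay the invocations of the list on a private copy of the sequential object, from
    tail.next up to announce[i], and return the last response

where `Node.max` scans the array `head` for a node with maximal `seq`. Every command below
makes at most one access to a memory location that other processes may write; `decide` is one
atomic access to a consensus object. -/

namespace Universal

/-- A node of the linked list. The state of the consensus object `decideNext` is the address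
that has been decided, if any. The sentinel has no invocation. -/
structure Node (M A : Type*) where
  invoc : Option (M × A)
  decideNext : Option ℕ
  seq : ℕ
  next : Option ℕ

/-- Shared memory. The addresses below `size` are allocated. -/
structure Mem (M A : Type*) (n : ℕ) where
  size : ℕ
  heap : ℕ → Node M A
  head : Fin n → ℕ
  announce : Fin n → ℕ

/-- Local states: program counter with the registers that are still in use; `Q` is the type of
states of the sequential object. -/
inductive Loc (M A B Q : Type*)
  | start (m : M) (a : A)
  | maxFirst
  | maxNext (j mx : ℕ)
  | maxSeq (j mx c : ℕ)
  | maxCmp (j mx c s : ℕ)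
  | test
  | readBefore
  | readSeq (before : ℕ)
  | readHelp (before s : ℕ)
  | testHelp (before help : ℕ)
  | decideAfter (before prefer : ℕ)
  | setNext (before after : ℕ)
  | readSeq' (before after : ℕ)
  | setSeq (after s : ℕ)
  | setHead (after : ℕ)
  | finish
  | readTail
  | replay (q : Q) (cur : ℕ)
  | advance (q : Q) (cur : ℕ)
  | done (b : B)

variable {M A B : Type*} {n : ℕ}

/-- Write a node into the heap. -/
def Mem.setNode (μ : Mem M A n) (x : ℕ) (v : Node M A) : Mem M A n :=
  { μ with heap := Function.update μ.heap x v }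

def newNode (i : Option (M × A)) : Node M A := ⟨i, none, 0, none⟩

/-- Initially the list consists of the sentinel, with sequence number `1`. -/
def initMem (M A : Type*) (n : ℕ) : Mem M A n where
  size := 1
  heap := Function.update (fun _ => newNode none) 0 ⟨none, none, 1, none⟩
  head := fun _ => 0
  announce := fun _ => 0

/-- Process `⟨0, _⟩`, which exists as soon as some process `p` does. -/
def first (p : Fin n) : Fin n := ⟨0, Nat.zero_lt_of_lt p.isLt⟩

/-- The process with index `k % n`. -/
def modProc (p : Fin n) (k : ℕ) : Fin n := ⟨k % n, Nat.mod_lt k (Nat.zero_lt_of_lt p.isLt)⟩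

def result {Q : Type*} : Loc M A B Q → Option B
  | .done b => some b
  | _ => none

/-- One command of process `p`. A null dereference (which the algorithm never meets) is a
command that has no effect. -/
def step (S : SeqLTS M A B) (p : Fin n) :
    Loc M A B S.State → Mem M A n → Loc M A B S.State → Mem M A n → Prop
  -- announce[p] := new Node(m, a)
  | .start m a, μ, l', μ' => l' = .maxFirst ∧
      μ' = { μ with
        size := μ.size + 1
        heap := Function.update μ.heap μ.size (newNode (some (m, a)))
        announce := Function.update μ.announce p μ.size }
  -- head[p] := Node.max(head)
  | .maxFirst, μ, l', μ' => l' = .maxNext 1 (μ.head (first p)) ∧ μ' = μ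
  | .maxNext j mx, μ, l', μ' =>
      if h : j < n then l' = .maxSeq j mx (μ.head ⟨j, h⟩) ∧ μ' = μ
      else l' = .test ∧ μ' = { μ with head := Function.update μ.head p mx }
  | .maxSeq j mx c, μ, l', μ' => l' = .maxCmp j mx c (μ.heap mx).seq ∧ μ' = μ
  | .maxCmp j mx c s, μ, l', μ' =>
      l' = .maxNext (j + 1) (if s < (μ.heap c).seq then c else mx) ∧ μ' = μ
  -- while announce[p].seq = 0
  | .test, μ, l', μ' =>
      l' = (if (μ.heap (μ.announce p)).seq = 0 then .readBefore else .finish) ∧ μ' = μ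
  -- before := head[p]
  | .readBefore, μ, l', μ' => l' = .readSeq (μ.head p) ∧ μ' = μ
  -- help := announce[(before.seq + 1) % n]
  | .readSeq before, μ, l', μ' => l' = .readHelp before (μ.heap before).seq ∧ μ' = μ
  | .readHelp before s, μ, l', μ' =>
      l' = .testHelp before (μ.announce (modProc p (s + 1))) ∧ μ' = μ
  -- if help.seq = 0 then prefer := help else prefer := announce[p]
  | .testHelp before help, μ, l', μ' =>
      l' = .decideAfter before (if (μ.heap help).seq = 0 then help else μ.announce p) ∧ μ' = μ
  -- after := before.decideNext.decide(prefer)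
  | .decideAfter before prefer, μ, l', μ' =>
      match (μ.heap before).decideNext with
      | some after => l' = .setNext before after ∧ μ' = μ
      | none => l' = .setNext before prefer ∧
          μ' = μ.setNode before { μ.heap before with decideNext := some prefer }
  -- before.next := after
  | .setNext before after, μ, l', μ' => l' = .readSeq' before after ∧
      μ' = μ.setNode before { μ.heap before with next := some after }
  -- after.seq := before.seq + 1
  | .readSeq' before after, μ, l', μ' => l' = .setSeq after (μ.heap before).seq ∧ μ' = μ
  | .setSeq after s, μ, l', μ' => l' = .setHead after ∧
      μ' = μ.setNode after { μ.heap after with seq := s + 1 }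
  -- head[p] := after
  | .setHead after, μ, l', μ' => l' = .test ∧
      μ' = { μ with head := Function.update μ.head p after }
  -- head[p] := announce[p]
  | .finish, μ, l', μ' => l' = .readTail ∧
      μ' = { μ with head := Function.update μ.head p (μ.announce p) }
  -- cur := tail.next
  | .readTail, μ, l', μ' => μ' = μ ∧
      l' = (match (μ.heap 0).next with
        | some c => .replay S.init c
        | none => .readTail)
  -- apply cur.invoc to the private copy; stop if cur = announce[p]
  | .replay q cur, μ, l', μ' => μ' = μ ∧
      match (μ.heap cur).invoc with
      | some (m, a) => ∃ b q', S.trans q ⟨m, a, b⟩ q' ∧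
          l' = if cur = μ.announce p then .done b else .advance q' cur
      | none => l' = .replay q cur
  -- cur := cur.next
  | .advance q cur, μ, l', μ' => μ' = μ ∧
      l' = (match (μ.heap cur).next with
        | some c => .replay q c
        | none => .advance q cur)
  | .done _, _, _, _ => False

theorem step_total (S : SeqLTS M A B) (hS : S.NonBlocking) (p : Fin n)
    (l : Loc M A B S.State) (μ : Mem M A n) (hl : result l = none) :
    ∃ l' μ', step S p l μ l' μ' := by
  cases l with
  | maxNext j mx =>
    simp only [step]
    split_ifs with h
    · exact ⟨_, _, rfl, rfl⟩
    · exact ⟨_, _, rfl, rfl⟩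
  | decideAfter before prefer =>
    simp only [step]
    cases (μ.heap before).decideNext with
    | none => exact ⟨_, _, rfl, rfl⟩
    | some x => exact ⟨_, _, rfl, rfl⟩
  | replay q cur =>
    simp only [step]
    cases (μ.heap cur).invoc with
    | none => exact ⟨_, _, rfl, rfl⟩
    | some x =>
      obtain ⟨b, q', h⟩ := hS q x.1 x.2
      exact ⟨_, _, rfl, b, q', h, rfl⟩
  | done b => simp [result] at hl
  | _ => exact ⟨_, _, rfl, rfl⟩

end Universal

/-- The object `A_Spec` for `n` processes, for a non-blocking sequential specification. -/
def ASpec {M A B : Type*} (S : SeqLTS M A B) (hS : S.NonBlocking) (n : ℕ) :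
    ConcObj M A B n where
  Mem := Universal.Mem M A n
  Loc := Universal.Loc M A B S.State
  initMem := Universal.initMem M A n
  entry := fun _ m a => .start m a
  result := Universal.result
  step := Universal.step S
  step_total := Universal.step_total S hS

/-! ### Sequential histories -/

namespace HAction

variable {M A B : Type*} {n : ℕ} (p : Fin n) (m : M) (a : A) (b : B)

/-! The universal construction linearizes an operation at a single step: the successful `decide`
that appends its node to the list. The simulation lets `O` execute an operation entirely at that
step. `O` answers a call with the call alone. When the node of `r` is appended, by `r` or by a
helper, process `r` runs alone in `O` until it is about to return. A return is answered by a return,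
and every other step by nothing. Since calls and returns leave the memory alone, the memory of `O`
is always one that a sequential execution `ops` reaches (`SeqReach`), and `ops` lists the operations
in the order of the nodes.

Two facts about `O` make this work. The solo run terminates: otherwise the sequential execution, the
call and the infinite solo run form a fair trace in which eventually one process is scheduled and a
pending call is followed by no return, against each of the three progress conditions
(`SoloProgress.exists_solo`). Its result is right: a sequential history has no pending calls, and
its happen-before order is total, so it is its own linearization and belongs to `Spec`
(`History.mem_of_linearizable_ofOps`). As `Spec` is deterministic, replaying the list up to a node
computes the result that `O` has already fixed for it (`step_cases`).

What remains is the safety of the list: no node enters twice, and every allocated node outside of it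
is announced by exactly one process (`ListInv`, `Fresh`, `RegInv`). Only whether a sequence number
is zero matters for this, not its value; neither the helping rule nor the termination of the
construction plays a role. -/

@[simp] theorem pid_call : (call p m a : HAction M A B n).pid = p := rfl

@[simp] theorem pid_ret : (ret p m b : HAction M A B n).pid = p := rfl

@[simp] theorem isCall_call : (call p m a : HAction M A B n).isCall = true := rfl

@[simp] theorem isCall_ret : (ret p m b : HAction M A B n).isCall = false := rfl

@[simp] theorem isRet_call : (call p m a : HAction M A B n).isRet = false := rfl

@[simp] theorem isRet_ret : (ret p m b : HAction M A B n).isRet = true := rfl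

end HAction

namespace History

variable {M A B : Type*} {n : ℕ}

/-- The sequential history in which the operations of `l` are executed one after the other. -/
def ofOps (l : List (Fin n × Op M A B)) : List (HAction M A B n) :=
  l.flatMap (fun x => [HAction.call x.1 x.2.meth x.2.arg, HAction.ret x.1 x.2.meth x.2.res])

@[simp] theorem ofOps_nil : ofOps ([] : List (Fin n × Op M A B)) = [] := rfl

@[simp] theorem ofOps_cons (x : Fin n × Op M A B) (l : List (Fin n × Op M A B)) :
    ofOps (x :: l) = HAction.call x.1 x.2.meth x.2.arg ::
      HAction.ret x.1 x.2.meth x.2.res :: ofOps l := rfl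

@[simp] theorem ofOps_append (l l' : List (Fin n × Op M A B)) :
    ofOps (l ++ l') = ofOps l ++ ofOps l' := by
  simp [ofOps]

theorem ofOps_injective : Function.Injective (ofOps (M := M) (A := A) (B := B) (n := n)) := by
  intro l
  induction l with
  | nil => intro l' h; cases l' <;> simp_all
  | cons x l ih =>
    intro l' h
    cases l' with
    | nil => simp at h
    | cons y l' =>
      obtain ⟨p, m, a, b⟩ := x
      obtain ⟨q, m', a', b'⟩ := y
      simp only [ofOps_cons, List.cons.injEq, HAction.call.injEq, HAction.ret.injEq] at h
      obtain ⟨⟨rfl, rfl, rfl⟩, ⟨-, -, rfl⟩, h⟩ := h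
      rw [ih h]

@[simp] theorem proj_append (h h' : List (HAction M A B n)) (p : Fin n) :
    proj (h ++ h') p = proj h p ++ proj h' p := by
  simp [proj]

theorem proj_ofOps (l : List (Fin n × Op M A B)) (p : Fin n) :
    proj (ofOps l) p = ofOps (l.filter (fun x => decide (x.1 = p))) := by
  induction l with
  | nil => rfl
  | cons x l ih =>
    have ih' := ih
    unfold proj at ih' ⊢
    by_cases hx : x.1 = p <;> simp [hx, ih']

/-- Each operation contributes one call and one return, so the rank of an operation is the same
whether it is read off its call or off its return. -/
theorem countP_isCall_ofOps (l : List (Fin n × Op M A B)) (p : Fin n) :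
    (proj (ofOps l) p).countP (fun e => e.isCall) =
      (proj (ofOps l) p).countP (fun e => e.isRet) := by
  rw [proj_ofOps]
  induction l.filter (fun x => decide (x.1 = p)) with
  | nil => rfl
  | cons x l ih => simpa [List.countP_cons] using ih

/-- After complete operations no call is left for a further return to match. -/
theorem eq_nil_of_isSequential_ofOps_append (l : List (Fin n × Op M A B))
    (r : List (HAction M A B n)) (hr : ∀ e ∈ r, e.isRet = true)
    (h : IsSequential (ofOps l ++ r)) : r = [] := by
  induction l with
  | nil =>
    match r, hr, h with
    | [], _, _ => rfl
    | HAction.call _ _ _ :: _, hr, _ => simp at hr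
    | HAction.ret _ _ _ :: _, _, h => simp [IsSequential] at h
  | cons x l ih => exact ih h.2.2

theorem complete_ofOps (l : List (Fin n × Op M A B)) : complete (ofOps l) = ofOps l := by
  induction l with
  | nil => rfl
  | cons x l ih =>
    rw [ofOps_cons, complete, if_pos ⟨_, _, List.mem_cons_self⟩, complete, ih]

theorem proj_eq_nil_of_filter_eq_nil {l : List (Fin n × Op M A B)} {p : Fin n}
    (h : ∀ x ∈ l, x.1 ≠ p) : proj (ofOps l) p = [] := by
  rw [proj_ofOps, List.filter_eq_nil_iff.2 (by simpa using h)]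
  rfl

theorem proj_single_call (p q : Fin n) (m : M) (a : A) :
    proj [(HAction.call p m a : HAction M A B n)] q = if p = q then [HAction.call p m a] else [] := by
  by_cases h : p = q <;> simp [proj, h]

/-- The call of the operation `x` that follows the operations `w`. -/
theorem invAt_ofOps (w t : List (Fin n × Op M A B)) (x : Fin n × Op M A B) :
    InvAt (ofOps (w ++ x :: t)) (x.1, (proj (ofOps w) x.1).countP (fun e => e.isCall))
      (ofOps w).length :=
  ⟨⟨HAction.call x.1 x.2.meth x.2.arg, by simp, rfl, rfl⟩, by simp⟩

/-- The return of the operation `x` that follows the operations `w`. -/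
theorem resAt_ofOps (w t : List (Fin n × Op M A B)) (x : Fin n × Op M A B) :
    ResAt (ofOps (w ++ x :: t)) (x.1, (proj (ofOps w) x.1).countP (fun e => e.isRet))
      ((ofOps w).length + 1) := by
  refine ⟨⟨HAction.ret x.1 x.2.meth x.2.res, by simp, rfl, rfl⟩, ?_⟩
  have : (ofOps (w ++ x :: t)).take ((ofOps w).length + 1) =
      ofOps w ++ [HAction.call x.1 x.2.meth x.2.arg] := by
    simp [List.take_append]
  rw [this, proj_append, List.countP_append, proj_single_call]
  simp

theorem countP_proj_mono {h h' : List (HAction M A B n)} (hs : h.Sublist h') (p : Fin n)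
    (f : HAction M A B n → Bool) : (proj h p).countP f ≤ (proj h' p).countP f :=
  (hs.filter _).countP_le

/-- No operation outside of `w` returns before the call of the operation `y` that follows `w`. -/
theorem not_happensBefore_ofOps (w t : List (Fin n × Op M A B)) (y : Fin n × Op M A B)
    (p : Fin n) :
    ¬ HappensBefore (ofOps (w ++ y :: t)) (p, (proj (ofOps w) p).countP (fun e => e.isRet))
      (y.1, (proj (ofOps w) y.1).countP (fun e => e.isCall)) := by
  rintro ⟨i, j, hij, ⟨⟨e, he, hep, her⟩, hi⟩, -, hj⟩
  -- Beyond this position the call of `y` itself has been counted, and the rank would be too large.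
  have hjw : j ≤ (ofOps w).length := by
    by_contra hlt
    push Not at hlt
    have hsub : (ofOps w ++ [HAction.call y.1 y.2.meth y.2.arg]).Sublist
        ((ofOps (w ++ y :: t)).take j) := by
      have : ofOps w ++ [HAction.call y.1 y.2.meth y.2.arg] =
          (ofOps (w ++ y :: t)).take ((ofOps w).length + 1) := by
        simp [List.take_append]
      rw [this]
      exact (List.take_prefix_take_left (by omega)).sublist
    have := countP_proj_mono hsub y.1 (fun e => e.isCall)
    rw [proj_append, List.countP_append, proj_single_call] at this
    simp only [if_true, HAction.isCall_call, List.countP_singleton] at this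
    simp only at hj
    omega
  -- As `i < j`, the return `e` lies inside `w`, so `w` would contain one more return of `p` than it
  -- does.
  have hsub : ((ofOps (w ++ y :: t)).take i ++ [e]).Sublist (ofOps w) := by
    have h1 : (ofOps (w ++ y :: t)).take i ++ [e] = (ofOps (w ++ y :: t)).take (i + 1) := by
      rw [List.take_add_one, he]; rfl
    have h2 : ofOps w = (ofOps (w ++ y :: t)).take (ofOps w).length := by simp
    rw [h1]
    conv_rhs => rw [h2]
    exact (List.take_prefix_take_left (by omega)).sublist
  have := countP_proj_mono hsub p (fun e => e.isRet)
  rw [proj_append, List.countP_append] at this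
  have h1 : proj [e] p = [e] := by simp [proj, hep]
  rw [h1, List.countP_singleton, her] at this
  simp only [if_true] at this
  simp only at hi
  omega

/-- Induction along a common prefix `w`. If the next operations `x` and `y` belong to the same
process, they agree by the projections. Otherwise `y` also occurs later in `t`, after `x` and as the
next operation of its process, so `x` happens before `y` in the first history; in the second one `y`
comes directly after `w`, when `x` has not returned. -/
theorem eq_of_happensBefore_preserved (t : List (Fin n × Op M A B)) :
    ∀ w t' : List (Fin n × Op M A B),
      (∀ p : Fin n, t.filter (fun x => decide (x.1 = p)) = t'.filter (fun x => decide (x.1 = p))) →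
      (∀ o₁ o₂, HasOp (ofOps (w ++ t)) o₁ → HasOp (ofOps (w ++ t)) o₂ →
        HappensBefore (ofOps (w ++ t)) o₁ o₂ → HappensBefore (ofOps (w ++ t')) o₁ o₂) →
      t = t' := by
  induction t with
  | nil =>
    intro w t' hf _
    cases t' with
    | nil => rfl
    | cons y t' => simpa using hf y.1
  | cons x t ih =>
    intro w t' hf hb
    cases t' with
    | nil => simpa using hf x.1
    | cons y t' =>
      by_cases hxy : x.1 = y.1
      · have h := hf x.1
        simp only [List.filter_cons, decide_true, if_true, ← hxy, List.cons.injEq] at h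
        obtain ⟨rfl, -⟩ := h
        rw [ih (w ++ [x]) t' ?_ (by simpa using hb)]
        intro p
        have h := hf p
        by_cases hp : x.1 = p <;> simpa [List.filter_cons, hp] using h
      · exfalso
        have h := hf y.1
        simp only [List.filter_cons, hxy, decide_false, decide_true, if_true] at h
        -- Nothing in `x :: u` belongs to the process of `y`, so `y` has the same rank after `w ++ x
        -- :: u` as after `w`.
        obtain ⟨u, v, rfl, hu, -⟩ := List.filter_eq_cons_iff.1 h
        have hu' : ∀ z ∈ x :: u, z.1 ≠ y.1 := by
          intro z hz
          rcases List.mem_cons.1 hz with rfl | hz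
          · exact hxy
          · simpa using hu z hz
        have hw : w ++ x :: (u ++ y :: v) = (w ++ x :: u) ++ y :: v := by simp
        have hc := proj_eq_nil_of_filter_eq_nil hu'
        have hi := invAt_ofOps (w ++ x :: u) v y
        have hr := resAt_ofOps (w ++ x :: u) v y
        rw [← hw, ofOps_append w (x :: u), proj_append, hc, List.append_nil] at hi hr
        rw [← countP_isCall_ofOps] at hr
        have hr' := resAt_ofOps w (u ++ y :: v) x
        exact not_happensBefore_ofOps w t' y x.1 (hb _ _ ⟨_, hr'⟩ ⟨_, hr⟩
          ⟨_, _, by simp, hr', hi⟩)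

/-- A linearizable sequential history belongs to the specification. -/
theorem mem_of_linearizable_ofOps {Spec : Set (List (Op M A B))} {l : List (Fin n × Op M A B)}
    (h : Linearizable Spec (ofOps l)) : l.map Prod.snd ∈ Spec := by
  obtain ⟨r, hr, hwf, s, ⟨l', hl', rfl⟩, heq, hb⟩ := h
  have hrnil : r = [] := by
    have hp : ∀ p, proj r p = [] := fun p => by
      have := hwf p
      rw [proj_append, proj_ofOps] at this
      exact eq_nil_of_isSequential_ofOps_append _ _
        (fun e he => hr e (List.mem_of_mem_filter he)) this
    cases r with
    | nil => rfl
    | cons e r => simpa [proj] using hp e.pid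
  subst hrnil
  rw [List.append_nil, complete_ofOps] at heq
  rw [List.append_nil] at hb
  have : l = l' := by
    refine eq_of_happensBefore_preserved l [] l' (fun p => ofOps_injective ?_) hb
    rw [← proj_ofOps, ← proj_ofOps]
    exact heq p
  rwa [this]

end History

/-! ### Runs -/

namespace LTS

variable {Lab : Type*} {A : LTS Lab}

theorem Run.append {q q₁ q₂ : A.State} {l l' : List Lab} (h : A.Run q l q₁)
    (h' : A.Run q₁ l' q₂) : A.Run q (l ++ l') q₂ := by
  induction h with
  | nil => exact h'
  | cons hx _ ih => exact .cons hx (ih h')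

theorem Run.single {q q' : A.State} {x : Lab} (h : A.trans q x q') : A.Run q [x] q' :=
  .cons h (.nil _)

theorem Run.split {q q₂ : A.State} {l l' : List Lab} (h : A.Run q (l ++ l') q₂) :
    ∃ q₁, A.Run q l q₁ ∧ A.Run q₁ l' q₂ := by
  induction l generalizing q with
  | nil => exact ⟨q, .nil _, h⟩
  | cons x l ih =>
    cases h with
    | cons hx h =>
      obtain ⟨q₁, h₁, h₂⟩ := ih h
      exact ⟨q₁, .cons hx h₁, h₂⟩

/-- A finite run followed by an infinite one. -/
theorem Run.append_infinite {q q' : A.State} {l : List Lab} (h : A.Run q l q') {t : ℕ → Lab}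
    (ht : ∃ s : ℕ → A.State, s 0 = q' ∧ ∀ i, A.trans (s i) (t i) (s (i + 1))) :
    ∃ t' : ℕ → Lab, (∃ s : ℕ → A.State, s 0 = q ∧ ∀ i, A.trans (s i) (t' i) (s (i + 1))) ∧
      ∀ i, t' (l.length + i) = t i := by
  induction h with
  | nil => exact ⟨t, ht, fun i => by simp⟩
  | @cons q q₁ q' x l hx _ ih =>
    obtain ⟨t', ⟨s, hs0, hs⟩, ht'⟩ := ih ht
    refine ⟨fun i => Nat.casesOn i x t', ⟨fun i => Nat.casesOn i q s, rfl, fun i => ?_⟩,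
      fun i => ?_⟩
    · cases i with
      | zero => simpa [hs0] using hx
      | succ i => exact hs i
    · rw [List.length_cons, Nat.add_right_comm]
      exact ht' i

end LTS

theorem SeqLTS.Deterministic.run_unique {M A B : Type*} {S : SeqLTS M A B}
    (hdet : S.Deterministic) {q q₁ q₂ : S.State} {l : List (Op M A B)}
    (h₁ : LTS.Run S q l q₁) (h₂ : LTS.Run S q l q₂) : q₁ = q₂ := by
  induction h₁ with
  | nil => cases h₂; rfl
  | cons hx _ ih =>
    cases h₂ with
    | cons hx' h₂ =>
      obtain rfl := (hdet _ _ _ _ _ _ _ hx hx').2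
      exact ih h₂

theorem history_append {M A B : Type*} {n : ℕ} (l l' : List (Label M A B n)) :
    history (l ++ l') = history l ++ history l' := List.filterMap_append

/-! ### Solo executions of an object -/

namespace ConcObj

variable {M A B : Type*} {n : ℕ} (O : ConcObj M A B n)

/-- One internal step of `p` on its local state and the memory. -/
def SoloStep (p : Fin n) (x y : O.Loc × O.Mem) : Prop :=
  O.result x.1 = none ∧ O.step p x.1 x.2 y.1 y.2

/-- Internal steps of `p` alone. -/
def Solo (p : Fin n) : O.Loc × O.Mem → O.Loc × O.Mem → Prop :=
  Relation.ReflTransGen (O.SoloStep p)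

variable {O}

/-- A solo run depends only on the local state and the memory. The same run can thus be executed
with all other processes idle, to prolong a sequential execution, and in the simulating
configuration, where other processes have called or are about to return. -/
theorem Solo.run {p : Fin n} {x y : O.Loc × O.Mem} (h : O.Solo p x y) (m : M) (c : O.Config)
    (hp : c.proc p = ProcState.busy m x.1) (hm : c.mem = x.2) :
    ∃ l, O.sem.Run c l ⟨Function.update c.proc p (ProcState.busy m y.1), y.2⟩ ∧
      history l = [] := by
  induction h with
  | refl =>
    refine ⟨[], ?_, rfl⟩
    rw [← hp, ← hm, Function.update_eq_self]
    exact .nil _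
  | tail _ hs ih =>
    obtain ⟨l, hl, hh⟩ := ih
    refine ⟨l ++ [Label.tau p], hl.append (.single ?_), by rw [history_append, hh]; rfl⟩
    have := Trans.internal (O := O) ⟨Function.update c.proc p (ProcState.busy m _), _⟩ p m _ _ _
      (Function.update_self ..) hs.1 hs.2
    rwa [Function.update_idem] at this

variable (O) in
/-- The memory `μ` is reached by executing the operations `l` one after the other. -/
def SeqReach (l : List (Fin n × Op M A B)) (μ : O.Mem) : Prop :=
  ∃ lab, O.sem.Run O.sem.init lab ⟨fun _ => ProcState.idle, μ⟩ ∧ history lab = History.ofOps l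

theorem SeqReach.nil : O.SeqReach [] O.initMem := ⟨[], .nil _, rfl⟩

theorem SeqReach.run_call {μ : O.Mem} (p : Fin n) (m : M) (a : A) :
    O.sem.trans ⟨fun _ => ProcState.idle, μ⟩ (Label.vis (HAction.call p m a))
      ⟨Function.update (fun _ => ProcState.idle) p (ProcState.busy m (O.entry p m a)), μ⟩ :=
  Trans.call (O := O) ⟨fun _ => ProcState.idle, μ⟩ p m a rfl

theorem SeqReach.snoc {l : List (Fin n × Op M A B)} {μ μ' : O.Mem} (h : O.SeqReach l μ)
    {p : Fin n} {m : M} {a : A} {b : B} {k : O.Loc} (hs : O.Solo p (O.entry p m a, μ) (k, μ'))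
    (hk : O.result k = some b) : O.SeqReach (l ++ [(p, ⟨m, a, b⟩)]) μ' := by
  obtain ⟨lab, hlab, hh⟩ := h
  obtain ⟨lab', hlab', hh'⟩ := hs.run m
    ⟨Function.update (fun _ => ProcState.idle) p (ProcState.busy m (O.entry p m a)), μ⟩
    (by simp) rfl
  have hret := Trans.ret (O := O)
    ⟨Function.update (fun _ => ProcState.idle) p (ProcState.busy m k), μ'⟩ p m k b
    (by simp) hk
  simp only [Function.update_idem] at hlab' hret
  have hid : Function.update (fun _ => ProcState.idle) p ProcState.idle =
      (fun _ : Fin n => (ProcState.idle : ProcState M O.Loc)) :=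
    Function.update_eq_self p (fun _ : Fin n => (ProcState.idle : ProcState M O.Loc))
  rw [hid] at hret
  refine ⟨lab ++ (Label.vis (HAction.call p m a) :: (lab' ++ [Label.vis (HAction.ret p m b)])),
    hlab.append (.cons (run_call p m a) (hlab'.append (.single hret))), ?_⟩
  rw [history_append, hh, History.ofOps_append]
  change _ ++ (HAction.call p m a :: history _) = _
  rw [history_append, hh']
  rfl

/-- Linearizability is used only here: it forces the results that `O` produces sequentially to be
those of `Spec`. -/
theorem SeqReach.mem_spec {Spec : Set (List (Op M A B))} (hlin : O.LinearizableWrt Spec)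
    {l : List (Fin n × Op M A B)} {μ : O.Mem} (h : O.SeqReach l μ) : l.map Prod.snd ∈ Spec := by
  obtain ⟨lab, hlab, hh⟩ := h
  exact History.mem_of_linearizable_ofOps (hh ▸ hlin lab ⟨_, hlab⟩)

variable (O) in
/-- In a fair trace where eventually one process is scheduled, pending calls are followed by
returns. This is implied by wait-freedom, by lock-freedom and by obstruction-freedom. -/
def SoloProgress : Prop :=
  ∀ t, O.sem.InfiniteTrace t → Progress.Sched t → Progress.Iso t → Progress.ProgS t

theorem ObstructionFree.soloProgress (h : O.ObstructionFree) : O.SoloProgress :=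
  fun t ht hs hi p i hp => (h t ht hs hi p i hp).imp fun _ hj => ⟨p, hj⟩

theorem WaitFree.soloProgress (h : O.WaitFree) : O.SoloProgress :=
  fun t ht hs _ p i hp => (h t ht hs p i hp).imp fun _ hj => ⟨p, hj⟩

theorem LockFree.soloProgress (h : O.LockFree) : O.SoloProgress :=
  fun t ht hs _ => h t ht hs

/-- An operation that runs alone after a sequential execution terminates. -/
theorem SoloProgress.exists_solo (hO : O.SoloProgress) {l : List (Fin n × Op M A B)} {μ : O.Mem}
    (h : O.SeqReach l μ) (p : Fin n) (m : M) (a : A) :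
    ∃ k μ' b, O.Solo p (O.entry p m a, μ) (k, μ') ∧ O.result k = some b := by
  by_contra hcon
  push Not at hcon
  have hnone : ∀ y, O.Solo p (O.entry p m a, μ) y → O.result y.1 = none := fun y hy =>
    Option.eq_none_iff_forall_ne_some.2 (hcon y.1 y.2 · hy)
  have hstep : ∀ y : {y // O.Solo p (O.entry p m a, μ) y},
      ∃ z : {y // O.Solo p (O.entry p m a, μ) y}, O.SoloStep p y.1 z.1 := by
    rintro ⟨y, hy⟩
    obtain ⟨k', μ', hk⟩ := O.step_total p y.1 y.2 (hnone y hy)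
    exact ⟨⟨(k', μ'), hy.tail ⟨hnone y hy, hk⟩⟩, hnone y hy, hk⟩
  choose f hf using hstep
  let s : ℕ → {y // O.Solo p (O.entry p m a, μ) y} := fun i => f^[i] ⟨_, .refl⟩
  have hs : ∀ i, O.SoloStep p (s i).1 (s (i + 1)).1 := fun i => by
    change O.SoloStep p _ (f^[i + 1] _).1
    rw [Function.iterate_succ_apply']
    exact hf _
  obtain ⟨lab, hlab, -⟩ := h
  have hinf : ∃ c : ℕ → O.sem.State,
      c 0 = ⟨Function.update (fun _ => ProcState.idle) p (ProcState.busy m (O.entry p m a)), μ⟩ ∧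
      ∀ i, O.sem.trans (c i) (Label.tau p) (c (i + 1)) := by
    refine ⟨fun i => ⟨Function.update (fun _ => ProcState.idle) p
      (ProcState.busy m (s i).1.1), (s i).1.2⟩, rfl, fun i => ?_⟩
    have := Trans.internal (O := O) ⟨Function.update (fun _ => ProcState.idle) p
      (ProcState.busy m (s i).1.1), (s i).1.2⟩ p m _ _ _ (by simp) (hs i).1 (hs i).2
    rwa [Function.update_idem] at this
  obtain ⟨c, hc0, hc⟩ := hinf
  obtain ⟨t, ht, htail⟩ := hlab.append_infinite
    -- The call sits at position `lab.length` of the whole trace, and all later steps are internal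
    -- steps of `p`.
    (t := fun i => Nat.casesOn i (Label.vis (HAction.call p m a)) fun _ => Label.tau p)
    ⟨fun i => Nat.casesOn i ⟨fun _ => ProcState.idle, μ⟩ c, rfl, fun i => by
      cases i with
      | zero =>
        change O.sem.trans _ _ (c 0)
        rw [hc0]
        exact SeqReach.run_call p m a
      | succ i => exact hc i⟩
  have hcall : (t lab.length).IsCallOf p := ⟨m, a, htail 0⟩
  have htau : ∀ j, lab.length < j → t j = Label.tau p := fun j hj => by
    obtain ⟨i, rfl⟩ := Nat.exists_eq_add_of_lt hj
    exact htail (i + 1)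
  have hret : ∀ j q, lab.length < j → ¬ (t j).IsRetOf q := by
    rintro j q hj ⟨m', b, h⟩
    simp [htau j hj] at h
  have hpid : ∀ j, lab.length + 1 ≤ j → (t j).pid = p := fun j hj => by
    rw [htau j hj]; rfl
  obtain ⟨j, q, hj, hjq⟩ := hO t ht
    (fun _ => ⟨p, ⟨_, hcall, fun j hj => hret j p hj⟩, fun i =>
      ⟨max i (lab.length + 1), le_max_left _ _, hpid _ (le_max_right _ _)⟩⟩)
    ⟨p, _, hpid⟩ p (lab.length + 1) ⟨_, Nat.lt_succ_self _, hcall, fun j hj _ => hret j p hj⟩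
  exact hret j q hj hjq

end ConcObj

/-! ### The list of the universal construction -/

theorem List.IsPrefix.getElem?_eq_some {α : Type*} {l l' : List α} (h : l <+: l') {i : ℕ} {x : α}
    (hx : l[i]? = some x) : l'[i]? = some x := by
  obtain ⟨t, rfl⟩ := h
  rw [List.getElem?_append_left (List.getElem?_eq_some_iff.1 hx).1, hx]

namespace Universal

variable {M A B : Type*} {n : ℕ}

/-- In the memory `μ`, the linked list consists of the addresses `L` (the sentinel first), and
its nodes hold the invocations of the operations `ops`. -/
structure ListInv (μ : Mem M A n) (L : List ℕ) (ops : List (Fin n × Op M A B)) : Prop where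
  zero : L[0]? = some 0
  nodup : L.Nodup
  lt_size : ∀ x ∈ L, x < μ.size
  mem_of_seq : ∀ x, (μ.heap x).seq ≠ 0 → x ∈ L
  decideNext_of_notMem : ∀ x, x ∉ L → (μ.heap x).decideNext = none
  decideNext_eq : ∀ i x, L[i]? = some x → (μ.heap x).decideNext = L[i + 1]?
  -- The last node is exempt: its number is written only after the decision that appends it.
  seq_ne_zero : ∀ i x, L[i]? = some x → i + 1 < L.length → (μ.heap x).seq ≠ 0
  decideNext_of_next : ∀ x y, (μ.heap x).next = some y → (μ.heap x).decideNext = some y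
  length_eq : L.length = ops.length + 1
  -- The sentinel shifts the indices: operation `i` is held by node `i + 1`.
  invoc_eq : ∀ i x, L[i + 1]? = some x →
    ∃ o, ops[i]? = some o ∧ (μ.heap x).invoc = some (o.2.meth, o.2.arg)
  head_seq : ∀ q, (μ.heap (μ.head q)).seq ≠ 0
  announce_lt : ∀ q, μ.announce q < μ.size
  exists_announce : ∀ x, x < μ.size → x ∉ L → ∃ q, μ.announce q = x
  announce_inj : ∀ q q', μ.announce q ∉ L → μ.announce q' = μ.announce q → q' = q

/-- If the successor of `w` is undecided, then `x` is not in the list. -/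
def Fresh (μ : Mem M A n) (L : List ℕ) (w x : ℕ) : Prop :=
  (μ.heap w).seq ≠ 0 ∧ x < μ.size ∧ ((μ.heap w).decideNext = none → x ∉ L)

/-- The facts about its registers that a process relies on. -/
def RegInv (S : SeqLTS M A B) (p : Fin n) (μ : Mem M A n) (L : List ℕ)
    (ops : List (Fin n × Op M A B)) : Loc M A B S.State → Prop
  | .maxNext _ mx => (μ.heap mx).seq ≠ 0
  | .maxSeq _ mx c => (μ.heap mx).seq ≠ 0 ∧ (μ.heap c).seq ≠ 0
  | .maxCmp _ mx c _ => (μ.heap mx).seq ≠ 0 ∧ (μ.heap c).seq ≠ 0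
  | .readBefore => Fresh μ L (μ.head p) (μ.announce p)
  | .readSeq before => Fresh μ L before (μ.announce p)
  | .readHelp before _ => Fresh μ L before (μ.announce p)
  | .testHelp before help => Fresh μ L before (μ.announce p) ∧ help < μ.size
  | .decideAfter before prefer => Fresh μ L before prefer
  | .setNext before after => (μ.heap before).decideNext = some after
  | .readSeq' _ after => after ∈ L
  | .setSeq after _ => after ∈ L
  | .setHead after => (μ.heap after).seq ≠ 0
  | .finish => (μ.heap (μ.announce p)).seq ≠ 0
  | .replay q cur => ∃ i, L[i + 1]? = some cur ∧ LTS.Run S S.init ((ops.take i).map Prod.snd) q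
  | .advance q cur => ∃ i, L[i + 1]? = some cur ∧
      LTS.Run S S.init ((ops.take (i + 1)).map Prod.snd) q
  | .done b => ∃ i o, L[i + 1]? = some (μ.announce p) ∧ ops[i]? = some o ∧ o.2.res = b
  | _ => True

/-- A change of the memory that is made by `p`, as the other processes see it. -/
structure Ext (p : Fin n) (μ : Mem M A n) (L : List ℕ) (ops : List (Fin n × Op M A B))
    (μ' : Mem M A n) (L' : List ℕ) (ops' : List (Fin n × Op M A B)) : Prop where
  seq : ∀ x, (μ.heap x).seq ≠ 0 → (μ'.heap x).seq ≠ 0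
  decideNext : ∀ x y, (μ.heap x).decideNext = some y → (μ'.heap x).decideNext = some y
  size : μ.size ≤ μ'.size
  invoc : ∀ x, x < μ.size → (μ'.heap x).invoc = (μ.heap x).invoc
  list : L <+: L'
  ops : ops <+: ops'
  announce : ∀ r, r ≠ p → μ'.announce r = μ.announce r
  head : ∀ r, r ≠ p → μ'.head r = μ.head r
  fresh : ∀ w x, Fresh μ L w x → (μ'.heap w).decideNext = none → x ∉ L'

variable {S : SeqLTS M A B} {p : Fin n} {μ μ' : Mem M A n} {L L' : List ℕ}
  {ops ops' : List (Fin n × Op M A B)}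

theorem Ext.refl : Ext p μ L ops μ L ops where
  seq _ h := h
  decideNext _ _ h := h
  size := le_rfl
  invoc _ _ := rfl
  list := List.prefix_rfl
  ops := List.prefix_rfl
  announce _ _ := rfl
  head _ _ := rfl
  fresh _ _ h := h.2.2

/-- A stale preference is harmless: as long as the successor of `w` is undecided, `w` is the last
node and nothing has been appended; afterwards the condition is void. -/
theorem Ext.fresh' (h : Ext p μ L ops μ' L' ops') {w x : ℕ} (hf : Fresh μ L w x) :
    Fresh μ' L' w x :=
  ⟨h.seq _ hf.1, hf.2.1.trans_le h.size, h.fresh w x hf⟩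

theorem ListInv.lt_length (h : ListInv μ L ops) {i x : ℕ} (hx : L[i + 1]? = some x) :
    i + 1 ≤ ops.length := by
  have := (List.getElem?_eq_some_iff.1 hx).1
  have := h.length_eq
  omega

/-- The facts about the registers of a process are stable under steps of other processes. -/
theorem RegInv.mono (hI : ListInv μ L ops) (h : Ext p μ L ops μ' L' ops') {r : Fin n}
    (hr : r ≠ p) {l : Loc M A B S.State} (hl : RegInv S r μ L ops l) :
    RegInv S r μ' L' ops' l := by
  have ha := h.announce r hr
  have hh := h.head r hr
  -- Operations are only appended, so the prefix already replayed stays the same.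
  have htake : ∀ i, i ≤ ops.length → ops'.take i = ops.take i := fun i hi => by
    obtain ⟨t, rfl⟩ := h.ops
    rw [List.take_append_of_le_length hi]
  cases l with
  | maxNext j mx => exact h.seq _ hl
  | maxSeq j mx c => exact ⟨h.seq _ hl.1, h.seq _ hl.2⟩
  | maxCmp j mx c s => exact ⟨h.seq _ hl.1, h.seq _ hl.2⟩
  | readBefore => simp only [RegInv, ha, hh] at hl ⊢; exact h.fresh' hl
  | readSeq before => simp only [RegInv, ha] at hl ⊢; exact h.fresh' hl
  | readHelp before s => simp only [RegInv, ha] at hl ⊢; exact h.fresh' hl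
  | testHelp before help =>
    simp only [RegInv, ha] at hl ⊢
    exact ⟨h.fresh' hl.1, hl.2.trans_le h.size⟩
  | decideAfter before prefer => exact h.fresh' hl
  | setNext before after => exact h.decideNext _ _ hl
  | readSeq' before after => exact h.list.subset hl
  | setSeq after s => exact h.list.subset hl
  | setHead after => exact h.seq _ hl
  | finish => simp only [RegInv, ha] at hl ⊢; exact h.seq _ hl
  | replay q cur =>
    obtain ⟨i, hi, hrun⟩ := hl
    exact ⟨i, h.list.getElem?_eq_some hi, by
      rwa [htake i (Nat.le_of_succ_le (hI.lt_length hi))]⟩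
  | advance q cur =>
    obtain ⟨i, hi, hrun⟩ := hl
    exact ⟨i, h.list.getElem?_eq_some hi, by rwa [htake (i + 1) (hI.lt_length hi)]⟩
  | done b =>
    obtain ⟨i, o, hi, ho, hb⟩ := hl
    exact ⟨i, o, ha ▸ h.list.getElem?_eq_some hi, h.ops.getElem?_eq_some ho, hb⟩
  | _ => trivial

/-- A list node whose number is zero must be the last one. If the successor of `w` is undecided,
then `w` is the last node, but its number is not zero. -/
theorem ListInv.fresh (h : ListInv μ L ops) {w x : ℕ} (hw : (μ.heap w).seq ≠ 0)
    (hx : (μ.heap x).seq = 0) (hlt : x < μ.size) : Fresh μ L w x := by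
  refine ⟨hw, hlt, fun hdec hxL => ?_⟩
  obtain ⟨i, hi⟩ := List.mem_iff_getElem?.1 (h.mem_of_seq w hw)
  obtain ⟨j, hj⟩ := List.mem_iff_getElem?.1 hxL
  have hlast := h.decideNext_eq i w hi
  rw [hdec, eq_comm, List.getElem?_eq_none_iff] at hlast
  have hjlt := (List.getElem?_eq_some_iff.1 hj).1
  rcases Nat.lt_or_ge (j + 1) L.length with hlt' | hge
  · exact h.seq_ne_zero j x hj hlt' hx
  · have : i = j := by have := (List.getElem?_eq_some_iff.1 hi).1; omega
    subst this
    rw [hi] at hj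
    cases hj
    exact hw hx

theorem ListInv.mem_of_decideNext (h : ListInv μ L ops) {w x : ℕ}
    (hw : (μ.heap w).decideNext = some x) : x ∈ L := by
  by_cases hwL : w ∈ L
  · obtain ⟨i, hi⟩ := List.mem_iff_getElem?.1 hwL
    rw [h.decideNext_eq i w hi] at hw
    exact List.mem_of_getElem? hw
  · rw [h.decideNext_of_notMem w hwL] at hw
    cases hw

theorem ListInv.next_eq (h : ListInv μ L ops) {i x y : ℕ} (hx : L[i]? = some x)
    (hy : (μ.heap x).next = some y) : L[i + 1]? = some y := by
  rw [← h.decideNext_eq i x hx]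
  exact h.decideNext_of_next x y hy

/-- The list invariant only concerns what is written. -/
theorem ListInv.congr (h : ListInv μ L ops) (hsize : μ'.size = μ.size)
    (hann : μ'.announce = μ.announce)
    (hdec : ∀ x, (μ'.heap x).decideNext = (μ.heap x).decideNext)
    (hinv : ∀ x, (μ'.heap x).invoc = (μ.heap x).invoc)
    (hseq : ∀ x, (μ.heap x).seq ≠ 0 → (μ'.heap x).seq ≠ 0)
    (hmem : ∀ x, (μ'.heap x).seq ≠ 0 → x ∈ L)
    (hnext : ∀ x y, (μ'.heap x).next = some y → (μ.heap x).decideNext = some y)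
    (hhead : ∀ q, (μ'.heap (μ'.head q)).seq ≠ 0) : ListInv μ' L ops where
  zero := h.zero
  nodup := h.nodup
  lt_size := by rw [hsize]; exact h.lt_size
  mem_of_seq := hmem
  decideNext_of_notMem x hx := by rw [hdec]; exact h.decideNext_of_notMem x hx
  decideNext_eq i x hx := by rw [hdec]; exact h.decideNext_eq i x hx
  seq_ne_zero i x hx hi := hseq x (h.seq_ne_zero i x hx hi)
  decideNext_of_next x y hy := by rw [hdec]; exact hnext x y hy
  length_eq := h.length_eq
  invoc_eq i x hx := by rw [hinv]; exact h.invoc_eq i x hx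
  head_seq := hhead
  announce_lt := by rw [hsize, hann]; exact h.announce_lt
  exists_announce := by rw [hsize, hann]; exact h.exists_announce
  announce_inj := by rw [hann]; exact h.announce_inj

/-! ### Effect of the memory writes on the list -/

theorem ListInv.setHead (h : ListInv μ L ops) (p : Fin n) {x : ℕ} (hx : (μ.heap x).seq ≠ 0) :
    ListInv { μ with head := Function.update μ.head p x } L ops ∧
      Ext p μ L ops { μ with head := Function.update μ.head p x } L ops := by
  refine ⟨h.congr rfl rfl (fun _ => rfl) (fun _ => rfl) (fun _ h => h) h.mem_of_seq
    h.decideNext_of_next fun q => ?_, ?_⟩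
  · by_cases hq : q = p
    · subst hq; simpa using hx
    · simpa [hq] using h.head_seq q
  · exact { Ext.refl (p := p) (μ := μ) (L := L) (ops := ops) with
      head := fun r hr => Function.update_of_ne hr _ _ }

theorem Mem.setNode_heap_self (μ : Mem M A n) (x : ℕ) (v : Node M A) :
    (μ.setNode x v).heap x = v := Function.update_self ..

theorem Mem.setNode_heap_of_ne (μ : Mem M A n) {x y : ℕ} (v : Node M A) (h : y ≠ x) :
    (μ.setNode x v).heap y = μ.heap y := Function.update_of_ne h ..

/-- The field `next` only copies a decision that has already been made, so repeated writes by
several processes agree. -/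
theorem ListInv.setNext (h : ListInv μ L ops) (p : Fin n) {w x : ℕ}
    (hw : (μ.heap w).decideNext = some x) :
    ListInv (μ.setNode w { μ.heap w with next := some x }) L ops ∧
      Ext p μ L ops (μ.setNode w { μ.heap w with next := some x }) L ops := by
  set μ' := μ.setNode w { μ.heap w with next := some x }
  have key : ∀ y, (μ'.heap y).decideNext = (μ.heap y).decideNext ∧
      (μ'.heap y).invoc = (μ.heap y).invoc ∧ (μ'.heap y).seq = (μ.heap y).seq := fun y => by
    by_cases hy : y = w
    · subst hy; simp [μ', Mem.setNode_heap_self]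
    · simp [μ', Mem.setNode_heap_of_ne _ _ hy]
  refine ⟨h.congr rfl rfl (fun y => (key y).1) (fun y => (key y).2.1)
    (fun y hy => by rwa [(key y).2.2]) (fun y hy => h.mem_of_seq y (by rwa [← (key y).2.2]))
    (fun y z hz => ?_) (fun q => by rw [(key _).2.2]; exact h.head_seq q), ?_⟩
  · by_cases hy : y = w
    · subst hy
      simp only [μ', Mem.setNode_heap_self] at hz
      rw [hw, hz]
    · rw [Mem.setNode_heap_of_ne _ _ hy] at hz
      exact h.decideNext_of_next y z hz
  · exact { Ext.refl (p := p) (μ := μ) (L := L) (ops := ops) with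
      seq := fun y hy => by rwa [(key y).2.2]
      decideNext := fun y z hz => by rwa [(key y).1]
      invoc := fun y _ => (key y).2.1
      fresh := fun y z hz hy => hz.2.2 (by rwa [← (key y).1]) }

/-- The value written is irrelevant as long as it is positive and the node is in the list. -/
theorem ListInv.setSeq (h : ListInv μ L ops) (p : Fin n) {x : ℕ} (hx : x ∈ L) (s : ℕ) :
    ListInv (μ.setNode x { μ.heap x with seq := s + 1 }) L ops ∧
      Ext p μ L ops (μ.setNode x { μ.heap x with seq := s + 1 }) L ops := by
  set μ' := μ.setNode x { μ.heap x with seq := s + 1 }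
  have key : ∀ y, (μ'.heap y).decideNext = (μ.heap y).decideNext ∧
      (μ'.heap y).invoc = (μ.heap y).invoc ∧ (μ'.heap y).next = (μ.heap y).next ∧
      ((μ.heap y).seq ≠ 0 → (μ'.heap y).seq ≠ 0) := fun y => by
    by_cases hy : y = x
    · subst hy; simp [μ', Mem.setNode_heap_self]
    · simp [μ', Mem.setNode_heap_of_ne _ _ hy]
  refine ⟨h.congr rfl rfl (fun y => (key y).1) (fun y => (key y).2.1)
    (fun y => (key y).2.2.2) (fun y hy => ?_)
    (fun y z hz => h.decideNext_of_next y z (by rwa [← (key y).2.2.1]))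
    (fun q => (key _).2.2.2 (h.head_seq q)), ?_⟩
  · by_cases hyx : y = x
    · rwa [hyx]
    · rw [Mem.setNode_heap_of_ne _ _ hyx] at hy
      exact h.mem_of_seq y hy
  · exact { Ext.refl (p := p) (μ := μ) (L := L) (ops := ops) with
      seq := fun y => (key y).2.2.2
      decideNext := fun y z hz => by rwa [(key y).1]
      invoc := fun y _ => (key y).2.1
      fresh := fun y z hz hy => hz.2.2 (by rwa [← (key y).1]) }

/-- Process `p` announces a new node. -/
def Mem.alloc (μ : Mem M A n) (p : Fin n) (m : M) (a : A) : Mem M A n :=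
  { μ with
    size := μ.size + 1
    heap := Function.update μ.heap μ.size (newNode (some (m, a)))
    announce := Function.update μ.announce p μ.size }

/-- The previous node of `p` is already in the list, so overwriting its announcement leaves no
pending node without an announcer. -/
theorem ListInv.alloc (h : ListInv μ L ops) {p : Fin n} (hp : μ.announce p ∈ L) (m : M) (a : A) :
    ListInv (μ.alloc p m a) L ops ∧ Ext p μ L ops (μ.alloc p m a) L ops := by
  set μ' := μ.alloc p m a
  have hsizeL : μ.size ∉ L := fun hm => (h.lt_size _ hm).false
  have hne : ∀ {x}, x < μ.size → μ'.heap x = μ.heap x := fun hx =>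
    Function.update_of_ne hx.ne ..
  have hself : μ'.heap μ.size = newNode (some (m, a)) := Function.update_self ..
  have hmem : ∀ {x}, x ∈ L → μ'.heap x = μ.heap x := fun hx => hne (h.lt_size _ hx)
  have hcases : ∀ x, μ'.heap x = newNode (some (m, a)) ∨ μ'.heap x = μ.heap x := fun x => by
    by_cases hx : x = μ.size
    · exact .inl (hx ▸ hself)
    · exact .inr (Function.update_of_ne hx ..)
  have hseq : ∀ x, (μ.heap x).seq ≠ 0 → (μ'.heap x).seq ≠ 0 := fun x hx => by
    rwa [hmem (h.mem_of_seq x hx)]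
  have hannp : μ'.announce p = μ.size := Function.update_self ..
  have hann : ∀ {r}, r ≠ p → μ'.announce r = μ.announce r := fun hr =>
    Function.update_of_ne hr ..
  refine ⟨?_, ?_⟩
  · exact {
      zero := h.zero
      nodup := h.nodup
      lt_size := fun x hx => (h.lt_size x hx).trans (Nat.lt_succ_self _)
      mem_of_seq := fun x hx => by
        rcases hcases x with hc | hc
        · simp [hc, newNode] at hx
        · exact h.mem_of_seq x (hc ▸ hx)
      decideNext_of_notMem := fun x hx => by
        rcases hcases x with hc | hc
        · rw [hc]; rfl
        · rw [hc]; exact h.decideNext_of_notMem x hx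
      decideNext_eq := fun i x hx => by
        rw [hmem (List.mem_of_getElem? hx)]; exact h.decideNext_eq i x hx
      seq_ne_zero := fun i x hx hi => hseq x (h.seq_ne_zero i x hx hi)
      decideNext_of_next := fun x y hy => by
        rcases hcases x with hc | hc
        · simp [hc, newNode] at hy
        · rw [hc] at hy ⊢; exact h.decideNext_of_next x y hy
      length_eq := h.length_eq
      invoc_eq := fun i x hx => by
        rw [hmem (List.mem_of_getElem? hx)]; exact h.invoc_eq i x hx
      head_seq := fun q => hseq _ (h.head_seq q)
      announce_lt := fun q => by
        by_cases hq : q = p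
        · rw [hq, hannp]; exact Nat.lt_succ_self _
        · rw [hann hq]; exact (h.announce_lt q).trans (Nat.lt_succ_self _)
      exists_announce := fun x hx hxL => by
        rcases Nat.lt_succ_iff_lt_or_eq.1 hx with hx | rfl
        · obtain ⟨q, rfl⟩ := h.exists_announce x hx hxL
          exact ⟨q, hann fun hq => hxL (hq ▸ hp)⟩
        · exact ⟨p, hannp⟩
      announce_inj := fun q q' hq heq => by
        by_cases h1 : q = p <;> by_cases h2 : q' = p
        · rw [h1, h2]
        · rw [h1, hannp, hann h2] at heq
          exact absurd heq (h.announce_lt q').ne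
        · rw [h2, hannp, hann h1] at heq
          exact absurd heq.symm (h.announce_lt q).ne
        · rw [hann h1] at hq
          rw [hann h1, hann h2] at heq
          exact h.announce_inj q q' hq heq }
  · exact {
      seq := hseq
      decideNext := fun x y hy => by
        rwa [hmem]
        by_contra hx
        rw [h.decideNext_of_notMem x hx] at hy
        cases hy
      size := Nat.le_succ _
      invoc := fun x hx => by rw [hne hx]
      list := List.prefix_rfl
      ops := List.prefix_rfl
      announce := fun r hr => hann hr
      head := fun _ _ => rfl
      fresh := fun w x hf hd => hf.2.2 (by rwa [hmem (h.mem_of_seq w hf.1)] at hd) }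

/-- An undecided list node is the last one, so deciding its successor appends. The process `r` and
the result `b` are free, because the list stores only invocations; the simulation takes them from
the run of `O`. -/
theorem ListInv.decide (h : ListInv μ L ops) (p r : Fin n) {w x : ℕ} (hf : Fresh μ L w x)
    (hw : (μ.heap w).decideNext = none) {m : M} {a : A} (b : B)
    (hx : (μ.heap x).invoc = some (m, a)) :
    ListInv (μ.setNode w { μ.heap w with decideNext := some x }) (L ++ [x])
        (ops ++ [(r, ⟨m, a, b⟩)]) ∧
      Ext p μ L ops (μ.setNode w { μ.heap w with decideNext := some x }) (L ++ [x])
        (ops ++ [(r, ⟨m, a, b⟩)]) := by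
  set μ' := μ.setNode w { μ.heap w with decideNext := some x }
  have hxL := hf.2.2 hw
  have hwL := h.mem_of_seq w hf.1
  have key : ∀ y, (μ'.heap y).seq = (μ.heap y).seq ∧
      (μ'.heap y).invoc = (μ.heap y).invoc ∧ (μ'.heap y).next = (μ.heap y).next := fun y => by
    by_cases hy : y = w
    · subst hy; simp [μ', Mem.setNode_heap_self]
    · simp [μ', Mem.setNode_heap_of_ne _ _ hy]
  have hself : (μ'.heap w).decideNext = some x := by simp [μ', Mem.setNode_heap_self]
  have hne : ∀ {y}, y ≠ w → (μ'.heap y).decideNext = (μ.heap y).decideNext := fun hy => by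
    simp [μ', Mem.setNode_heap_of_ne _ _ hy]
  obtain ⟨k, hk⟩ := List.mem_iff_getElem?.1 hwL
  have hlast := h.decideNext_eq k w hk
  rw [hw, eq_comm, List.getElem?_eq_none_iff] at hlast
  have hklt := (List.getElem?_eq_some_iff.1 hk).1
  have hlen : L.length = k + 1 := by omega
  have hsplit : ∀ {i y}, (L ++ [x])[i]? = some y → L[i]? = some y ∨ (i = L.length ∧ y = x) := by
    intro i y hy
    rcases Nat.lt_or_ge i L.length with hi | hi
    · rw [List.getElem?_append_left hi] at hy
      exact .inl hy
    · rw [List.getElem?_append_right hi, List.getElem?_singleton] at hy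
      split_ifs at hy with h0
      exact .inr ⟨by omega, by simpa using hy.symm⟩
  refine ⟨?_, ?_⟩
  · exact {
      zero := (List.prefix_append L [x]).getElem?_eq_some h.zero
      nodup := List.nodup_append.2 ⟨h.nodup, List.nodup_singleton x, by
        rintro y hy z hz rfl
        exact hxL (by simpa using List.mem_singleton.1 hz ▸ hy)⟩
      lt_size := fun y hy => by
        rcases List.mem_append.1 hy with hy | hy
        · exact h.lt_size y hy
        · rw [List.mem_singleton.1 hy]; exact hf.2.1
      mem_of_seq := fun y hy => List.mem_append_left _ (h.mem_of_seq y (by rwa [← (key y).1]))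
      decideNext_of_notMem := fun y hy => by
        have hyL : y ∉ L := fun h => hy (List.mem_append_left _ h)
        rw [hne (by rintro rfl; exact hyL hwL)]
        exact h.decideNext_of_notMem y hyL
      decideNext_eq := fun i y hy => by
        rcases hsplit hy with hy | ⟨rfl, rfl⟩
        · by_cases hyw : y = w
          · subst hyw
            have : i = k := (List.getElem?_inj (List.getElem?_eq_some_iff.1 hy).1 h.nodup).1
              (hy.trans hk.symm)
            subst this
            rw [hself, ← hlen]
            simp
          · rw [hne hyw, h.decideNext_eq i y hy]
            have hi : i ≠ k := by
              rintro rfl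
              rw [hk] at hy
              exact hyw (by simpa using hy.symm)
            have := (List.getElem?_eq_some_iff.1 hy).1
            rw [List.getElem?_append_left (by omega)]
        · rw [hne (by rintro rfl; exact hxL hwL), h.decideNext_of_notMem _ hxL]
          simp
      seq_ne_zero := fun i y hy hi => by
        rw [(key y).1]
        rcases hsplit hy with hy | ⟨rfl, rfl⟩
        · rcases Nat.lt_or_ge (i + 1) L.length with hi' | hi'
          · exact h.seq_ne_zero i y hy hi'
          · have := (List.getElem?_eq_some_iff.1 hy).1
            obtain rfl : i = k := by omega
            rw [hk] at hy
            cases hy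
            exact hf.1
        · simp at hi
      decideNext_of_next := fun y z hz => by
        rw [(key y).2.2] at hz
        have hd := h.decideNext_of_next y z hz
        rwa [hne]
        rintro rfl
        rw [hw] at hd
        cases hd
      length_eq := by simp [h.length_eq]
      invoc_eq := fun i y hy => by
        rw [(key y).2.1]
        rcases hsplit hy with hy | ⟨hi, rfl⟩
        · obtain ⟨o, ho, hoi⟩ := h.invoc_eq i y hy
          exact ⟨o, (List.prefix_append ops _).getElem?_eq_some ho, hoi⟩
        · have := h.length_eq
          obtain rfl : i = ops.length := by omega
          exact ⟨(r, ⟨m, a, b⟩), by simp, hx⟩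
      head_seq := fun q => by rw [(key _).1]; exact h.head_seq q
      announce_lt := h.announce_lt
      exists_announce := fun y hy hyL =>
        h.exists_announce y hy fun h => hyL (List.mem_append_left _ h)
      announce_inj := fun q q' hq => h.announce_inj q q' fun h => hq (List.mem_append_left _ h) }
  · exact {
      seq := fun y hy => by rwa [(key y).1]
      decideNext := fun y z hz => by
        rwa [hne]
        rintro rfl
        rw [hw] at hz
        cases hz
      size := le_rfl
      invoc := fun y _ => (key y).2.1
      list := List.prefix_append _ _
      ops := List.prefix_append _ _
      announce := fun _ _ => rfl
      head := fun _ _ => rfl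
      -- Void: before the step `w` was the only undecided node of the list, and now it is decided.
      fresh := fun v y hv hd => by
        exfalso
        have hvw : v ≠ w := by rintro rfl; rw [hself] at hd; cases hd
        rw [hne hvw] at hd
        obtain ⟨i, hi⟩ := List.mem_iff_getElem?.1 (h.mem_of_seq v hv.1)
        have hi' := h.decideNext_eq i v hi
        rw [hd, eq_comm, List.getElem?_eq_none_iff] at hi'
        have := (List.getElem?_eq_some_iff.1 hi).1
        obtain rfl : i = k := by omega
        rw [hk] at hi
        exact hvw (by simpa using hi.symm) }

theorem listInv_init : ListInv (initMem M A n) [0] ([] : List (Fin n × Op M A B)) := by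
  have h0 : (initMem M A n).heap 0 = ⟨none, none, 1, none⟩ := by
    simp [initMem]
  have hne : ∀ {x}, x ≠ 0 → (initMem M A n).heap x = newNode none := fun hx => by
    simp [initMem, hx]
  have hdec : ∀ x, ((initMem M A n).heap x).decideNext = none ∧
      ((initMem M A n).heap x).next = none := fun x => by
    by_cases hx : x = 0
    · rw [hx, h0]; exact ⟨rfl, rfl⟩
    · rw [hne hx]; exact ⟨rfl, rfl⟩
  exact {
    zero := rfl
    nodup := List.nodup_singleton 0
    lt_size := by simp [initMem]
    mem_of_seq := fun x hx => by
      by_contra hx0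
      rw [hne (by simpa using hx0)] at hx
      exact hx rfl
    decideNext_of_notMem := fun x _ => (hdec x).1
    decideNext_eq := fun i x hx => by rw [(hdec x).1]; simp
    seq_ne_zero := fun i x _ hi => by simp at hi
    decideNext_of_next := fun x y hy => by rw [(hdec x).2] at hy; cases hy
    length_eq := rfl
    invoc_eq := fun i x hx => by simp at hx
    head_seq := fun q => by
      change ((initMem M A n).heap 0).seq ≠ 0
      rw [h0]; exact one_ne_zero
    announce_lt := fun q => Nat.one_pos
    exists_announce := fun x hx hx0 => absurd (Nat.lt_one_iff.1 hx) (by simpa using hx0)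
    announce_inj := fun q q' hq => absurd (List.mem_singleton.2 rfl) hq }

end Universal

/-! ### The simulation -/

namespace Universal

variable {M A B : Type*} {n : ℕ} (S : SeqLTS M A B) (O : ConcObj M A B n)

/-- The state `d` in `O` of a process with an announced node, which runs `m`: it has only
called `m` if its node is not in the list, and is about to return otherwise. -/
def Engaged (p : Fin n) (m : M) (d : ProcState M O.Loc) (μ : Mem M A n) (L : List ℕ)
    (ops : List (Fin n × Op M A B)) : Prop :=
  (μ.announce p ∉ L ∧ ∃ a, (μ.heap (μ.announce p)).invoc = some (m, a) ∧
    d = ProcState.busy m (O.entry p m a)) ∨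
  (∃ i o k, L[i + 1]? = some (μ.announce p) ∧ ops[i]? = some o ∧
    d = ProcState.busy m k ∧ O.result k = some o.2.res)

/-- The state `s` of `p` in the universal construction is related to its state `d` in `O`. -/
def Link (p : Fin n) (s : ProcState M (Loc M A B S.State)) (d : ProcState M O.Loc)
    (μ : Mem M A n) (L : List ℕ) (ops : List (Fin n × Op M A B)) : Prop :=
  (s = ProcState.idle ∧ d = ProcState.idle ∧ μ.announce p ∈ L) ∨
  (∃ m a, s = ProcState.busy m (.start m a) ∧ d = ProcState.busy m (O.entry p m a) ∧
    μ.announce p ∈ L) ∨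
  (∃ m l, s = ProcState.busy m l ∧ (∀ m' a, l ≠ .start m' a) ∧ RegInv S p μ L ops l ∧
    Engaged O p m d μ L ops)

variable {S O} {p : Fin n} {μ μ' : Mem M A n} {L L' : List ℕ} {ops ops' : List (Fin n × Op M A B)}

/-- The hypothesis `ha` takes the place of `r ≠ p`, so that this also applies to the process that
makes the step. -/
theorem Engaged.mono (hI : ListInv μ L ops) (h : Ext p μ L ops μ' L' ops') {r : Fin n} {m : M}
    {d : ProcState M O.Loc} (ha : μ'.announce r = μ.announce r)
    (hL : μ.announce r ∉ L → μ.announce r ∉ L') (hr : Engaged O r m d μ L ops) :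
    Engaged O r m d μ' L' ops' := by
  rcases hr with ⟨hn, a, hinv, hd⟩ | ⟨i, o, k, hi, ho, hd, hk⟩
  · exact .inl ⟨ha ▸ hL hn, a, by rw [ha, h.invoc _ (hI.announce_lt r), hinv], hd⟩
  · exact .inr ⟨i, o, k, ha ▸ h.list.getElem?_eq_some hi, h.ops.getElem?_eq_some ho, hd, hk⟩

/-- Steps of `p` that do not put the node of another process `r` into the list preserve the
relation for `r`. -/
theorem Link.mono (hI : ListInv μ L ops) (h : Ext p μ L ops μ' L' ops') {r : Fin n} (hr : r ≠ p)
    {s : ProcState M (Loc M A B S.State)} {d : ProcState M O.Loc}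
    (hL : μ.announce r ∉ L → μ.announce r ∉ L') (hl : Link S O r s d μ L ops) :
    Link S O r s d μ' L' ops' := by
  have ha := h.announce r hr
  rcases hl with ⟨hs, hd, hm⟩ | ⟨m, a, hs, hd, hm⟩ | ⟨m, l, hs, hns, hreg, he⟩
  · exact .inl ⟨hs, hd, ha ▸ h.list.subset hm⟩
  · exact .inr (.inl ⟨m, a, hs, hd, ha ▸ h.list.subset hm⟩)
  · exact .inr (.inr ⟨m, l, hs, hns, hreg.mono hI h hr, he.mono hI h ha hL⟩)

variable (S O) in
/-- The simulation relation. -/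
def SimRel (hS : S.NonBlocking) (c : (ASpec S hS n).Config) (d : O.Config) : Prop :=
  ∃ (L : List ℕ) (ops : List (Fin n × Op M A B)), ListInv c.mem L ops ∧ O.SeqReach ops d.mem ∧
    ∀ p, Link S O p (c.proc p) (d.proc p) c.mem L ops

theorem ListInv.index_unique (h : ListInv μ L ops) {i j x : ℕ} (hi : L[i]? = some x)
    (hj : L[j]? = some x) : i = j :=
  (List.getElem?_inj (List.getElem?_eq_some_iff.1 hi).1 h.nodup).1 (hi.trans hj.symm)

/-- The steps of the universal construction other than the announcement and the successful
decisions only preserve the invariants. -/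
theorem step_cases (hdet : S.Deterministic) (hI : ListInv μ L ops)
    (hspec : ops.map Prod.snd ∈ S.spec) {l l' : Loc M A B S.State}
    (hreg : RegInv S p μ L ops l) (hs : step S p l μ l' μ') :
    (∃ m a, l = .start m a ∧ l' = .maxFirst ∧ μ' = μ.alloc p m a) ∨
    (∃ w x, l' = .setNext w x ∧ Fresh μ L w x ∧ (μ.heap w).decideNext = none ∧
      μ' = μ.setNode w { μ.heap w with decideNext := some x }) ∨
    ((∀ m a, l' ≠ .start m a) ∧ ListInv μ' L ops ∧ Ext p μ L ops μ' L ops ∧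
      μ'.announce = μ.announce ∧ RegInv S p μ' L ops l') := by
  have same : ∀ {l' : Loc M A B S.State} {μ' : Mem M A n}, μ' = μ → (∀ m a, l' ≠ .start m a) →
      RegInv S p μ L ops l' → ((∀ m a, l' ≠ .start m a) ∧ ListInv μ' L ops ∧
        Ext p μ L ops μ' L ops ∧ μ'.announce = μ.announce ∧ RegInv S p μ' L ops l') := by
    rintro l' μ' rfl hl hr
    exact ⟨hl, hI, .refl, rfl, hr⟩
  cases l with
  | start m a => exact .inl ⟨m, a, rfl, hs⟩
  | maxFirst =>
    obtain ⟨rfl, rfl⟩ := hs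
    exact .inr (.inr (same rfl (by simp) (hI.head_seq _)))
  | maxNext j mx =>
    right; right
    simp only [step] at hs
    split_ifs at hs with hj
    · obtain ⟨rfl, rfl⟩ := hs
      exact same rfl (by simp) ⟨hreg, hI.head_seq _⟩
    · obtain ⟨rfl, rfl⟩ := hs
      obtain ⟨h1, h2⟩ := hI.setHead p hreg
      exact ⟨by simp, h1, h2, rfl, trivial⟩
  | maxSeq j mx c =>
    obtain ⟨rfl, rfl⟩ := hs
    exact .inr (.inr (same rfl (by simp) hreg))
  | maxCmp j mx c s =>
    obtain ⟨rfl, rfl⟩ := hs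
    refine .inr (.inr (same rfl (by simp) ?_))
    simp only [RegInv]
    split_ifs
    · exact hreg.2
    · exact hreg.1
  | test =>
    obtain ⟨rfl, rfl⟩ := hs
    right; right
    split_ifs with h0
    · exact same rfl (by simp) (hI.fresh (hI.head_seq p) h0 (hI.announce_lt p))
    · exact same rfl (by simp) h0
  | readBefore =>
    obtain ⟨rfl, rfl⟩ := hs
    exact .inr (.inr (same rfl (by simp) hreg))
  | readSeq before =>
    obtain ⟨rfl, rfl⟩ := hs
    exact .inr (.inr (same rfl (by simp) hreg))
  | readHelp before s =>
    obtain ⟨rfl, rfl⟩ := hs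
    exact .inr (.inr (same rfl (by simp) ⟨hreg, hI.announce_lt _⟩))
  | testHelp before help =>
    obtain ⟨rfl, rfl⟩ := hs
    refine .inr (.inr (same rfl (by simp) ?_))
    simp only [RegInv]
    split_ifs with h0
    -- The helped node was just seen with number zero; in the other case the own node has kept its
    -- freshness since the loop test.
    · exact hI.fresh hreg.1.1 h0 hreg.2
    · exact hreg.1
  | decideAfter before prefer =>
    right
    simp only [step] at hs
    cases hd : (μ.heap before).decideNext with
    | none =>
      rw [hd] at hs
      exact .inl ⟨before, prefer, hs.1, hreg, hd, hs.2⟩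
    | some after =>
      rw [hd] at hs
      obtain ⟨rfl, rfl⟩ := hs
      exact .inr (same rfl (by simp) hd)
  | setNext before after =>
    obtain ⟨rfl, rfl⟩ := hs
    obtain ⟨h1, h2⟩ := hI.setNext p hreg
    exact .inr (.inr ⟨by simp, h1, h2, rfl, hI.mem_of_decideNext hreg⟩)
  | readSeq' before after =>
    obtain ⟨rfl, rfl⟩ := hs
    exact .inr (.inr (same rfl (by simp) hreg))
  | setSeq after s =>
    obtain ⟨rfl, rfl⟩ := hs
    obtain ⟨h1, h2⟩ := hI.setSeq p hreg s
    refine .inr (.inr ⟨by simp, h1, h2, rfl, ?_⟩)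
    simp only [RegInv, Mem.setNode_heap_self]
    exact Nat.succ_ne_zero s
  | setHead after =>
    obtain ⟨rfl, rfl⟩ := hs
    obtain ⟨h1, h2⟩ := hI.setHead p hreg
    exact .inr (.inr ⟨by simp, h1, h2, rfl, trivial⟩)
  | finish =>
    obtain ⟨rfl, rfl⟩ := hs
    obtain ⟨h1, h2⟩ := hI.setHead p hreg
    exact .inr (.inr ⟨by simp, h1, h2, rfl, trivial⟩)
  | readTail =>
    obtain ⟨rfl, rfl⟩ := hs
    right; right
    cases hn : (μ'.heap 0).next with
    | none => exact same rfl (by simp) trivial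
    | some c => exact same rfl (by simp) ⟨0, hI.next_eq hI.zero hn, .nil _⟩
  | replay q cur =>
    obtain ⟨rfl, hs⟩ := hs
    right; right
    obtain ⟨i, hi, hrun⟩ := hreg
    obtain ⟨o, ho, hoi⟩ := hI.invoc_eq i cur hi
    rw [hoi] at hs
    obtain ⟨b, q', ht, rfl⟩ := hs
    have htake : (ops.take (i + 1)).map Prod.snd = (ops.take i).map Prod.snd ++ [o.2] := by
      rw [List.take_add_one, ho]; simp
    -- The run of `S` along `ops` passes through the state of the private copy after `i` operations,
    -- by determinism, and so gives the same next result.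
    have hb : b = o.2.res := by
      obtain ⟨qf, hqf⟩ := hspec
      rw [← List.take_append_drop (i + 1) ops, List.map_append, htake] at hqf
      obtain ⟨q₂, hq₂, -⟩ := LTS.Run.split hqf
      obtain ⟨q₁, hq₁, hlast⟩ := LTS.Run.split hq₂
      obtain rfl := hdet.run_unique hrun hq₁
      cases hlast with
      | cons ht' _ => exact (hdet _ _ _ _ _ _ _ ht ht').1
    split_ifs with hc
    · exact same rfl (by simp) ⟨i, o, hc ▸ hi, ho, hb.symm⟩
    · refine same rfl (by simp) ⟨i, hi, ?_⟩
      rw [htake]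
      subst hb
      exact LTS.Run.append hrun (.single ht)
  | advance q cur =>
    obtain ⟨rfl, rfl⟩ := hs
    right; right
    cases hn : (μ'.heap cur).next with
    | none => exact same rfl (by simp) hreg
    | some c =>
      obtain ⟨i, hi, hrun⟩ := hreg
      exact same rfl (by simp) ⟨i + 1, hI.next_eq hi hn, hrun⟩
  | done b => exact hs.elim

theorem Link.of_busy {m : M} {l : Loc M A B S.State} {d : ProcState M O.Loc}
    (h : Link S O p (ProcState.busy m l) d μ L ops) :
    (∃ a, l = .start m a ∧ d = ProcState.busy m (O.entry p m a) ∧ μ.announce p ∈ L) ∨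
    ((∀ m' a, l ≠ .start m' a) ∧ RegInv S p μ L ops l ∧ Engaged O p m d μ L ops) := by
  rcases h with ⟨hs, -⟩ | ⟨m', a, hs, hd, hm⟩ | ⟨m', l', hs, hns, hreg, he⟩
  · cases hs
  · cases hs; exact .inl ⟨a, rfl, hd, hm⟩
  · cases hs; exact .inr ⟨hns, hreg, he⟩

theorem Link.regInv {m : M} {l : Loc M A B S.State} {d : ProcState M O.Loc}
    (h : Link S O p (ProcState.busy m l) d μ L ops) : RegInv S p μ L ops l := by
  rcases h.of_busy with ⟨a, rfl, -⟩ | ⟨-, hreg, -⟩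
  · trivial
  · exact hreg

theorem simRel_init (hS : S.NonBlocking) :
    SimRel S O hS (ASpec S hS n).sem.init O.sem.init :=
  ⟨[0], [], listInv_init, .nil, fun _ => .inl ⟨rfl, rfl, List.mem_singleton.2 rfl⟩⟩

/-- When the node of `r` enters the list, `r` runs alone in `O` until it is about to return. -/
theorem sim_decide {hS : S.NonBlocking} (hO : O.SoloProgress) {c : (ASpec S hS n).Config}
    {d : O.Config} (hI : ListInv c.mem L ops) (hd : O.SeqReach ops d.mem)
    (hl : ∀ p, Link S O p (c.proc p) (d.proc p) c.mem L ops) {m : M} {l : Loc M A B S.State}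
    (hp : c.proc p = ProcState.busy m l) (hns : ∀ m' a, l ≠ .start m' a) {w x : ℕ}
    (hf : Fresh c.mem L w x) (hw : ((c.mem : Mem M A n).heap w).decideNext = none) :
    ∃ lab d', O.sem.Run d lab d' ∧ history lab = [] ∧ SimRel S O hS
      ⟨Function.update c.proc p (ProcState.busy m (.setNext w x)),
        Mem.setNode c.mem w { Mem.heap c.mem w with decideNext := some x }⟩ d' := by
  obtain ⟨procs, μ⟩ := c
  change Mem M A n at μ
  change Fin n → ProcState M (Loc M A B S.State) at procs
  simp only at hI hl hp hf hw ⊢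
  have hxL := hf.2.2 hw
  -- The owner of the appended node, either `p` itself or a process that `p` helps.
  obtain ⟨r, hr⟩ := hI.exists_announce x hf.2.1 hxL
  have hrL : μ.announce r ∉ L := hr ▸ hxL
  have hrlink : ∃ mr lr, procs r = ProcState.busy mr lr ∧ (∀ m' a, lr ≠ .start m' a) ∧
      RegInv S r μ L ops lr ∧ Engaged O r mr (d.proc r) μ L ops := by
    -- An idle or starting process has its announced node in the list, so `r` is in the midst of its
    -- operation.
    rcases hl r with ⟨-, -, hm⟩ | ⟨_, _, -, -, hm⟩ | h
    · exact absurd hm hrL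
    · exact absurd hm hrL
    · exact h
  obtain ⟨mr, lr, hpr, hlr, hregr, hengr⟩ := hrlink
  rcases hengr with ⟨-, a, hinv, hdr⟩ | ⟨i, _, _, hi, -⟩
  swap
  · exact absurd (List.mem_of_getElem? hi) hrL
  -- Termination comes from the sequential configuration with the same memory as `d`; the run is
  -- then carried over to `d`.
  obtain ⟨k, ν, b, hsolo, hk⟩ := hO.exists_solo hd r mr a
  obtain ⟨lab, hlab, hh⟩ := hsolo.run mr d hdr rfl
  obtain ⟨hI', hE⟩ := hI.decide p r hf hw b (hr ▸ hinv)
  have hengr' : Engaged O r mr (ProcState.busy mr k)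
      (μ.setNode w { μ.heap w with decideNext := some x }) (L ++ [x])
      (ops ++ [(r, ⟨mr, a, b⟩)]) := by
    refine .inr ⟨ops.length, _, k, ?_, List.getElem?_concat_length .., rfl, hk⟩
    rw [← hI.length_eq]
    exact (List.getElem?_concat_length ..).trans (congrArg some hr.symm)
  -- No process other than `r` announces `x`, so the nodes of the others stay outside of the list.
  have hkeep : ∀ q, q ≠ r → μ.announce q ∉ L → μ.announce q ∉ L ++ [x] := by
    intro q hq hqL hmem
    rcases List.mem_append.1 hmem with hmem | hmem
    · exact hqL hmem
    · exact hq (hI.announce_inj r q hrL ((List.mem_singleton.1 hmem).trans hr.symm))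
  refine ⟨lab, _, hlab, hh, L ++ [x], _, hI', hd.snoc hsolo hk, fun q => ?_⟩
  by_cases hqp : q = p
  · subst hqp
    refine .inr (.inr ⟨m, _, Function.update_self .., by simp,
      congrArg Node.decideNext (Mem.setNode_heap_self μ w _), ?_⟩)
    by_cases hqr : q = r
    · subst hqr
      rw [hp] at hpr
      cases hpr
      simpa using hengr'
    · simp only [Function.update_of_ne hqr]
      have hlq := hl q
      rw [hp] at hlq
      rcases hlq.of_busy with ⟨a', rfl, -⟩ | ⟨-, -, he⟩
      · exact absurd rfl (hns _ _)
      · exact he.mono hI hE rfl (hkeep q hqr)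
  · have hq : Function.update procs p (ProcState.busy m (.setNext w x)) q = procs q :=
      Function.update_of_ne hqp ..
    by_cases hqr : q = r
    · subst hqr
      simp only [Function.update_self]
      exact .inr (.inr ⟨mr, lr, hq.trans hpr, hlr, hregr.mono hI hE hqp, hengr'⟩)
    · simp only [Function.update_of_ne hqr]
      change Link S O q (Function.update procs p (ProcState.busy m (.setNext w x)) q) _ _ _ _
      rw [hq]
      exact (hl q).mono hI hE hqp (hkeep q hqr)

theorem sim_step (hdet : S.Deterministic) {hS : S.NonBlocking} (hlin : O.LinearizableWrt S.spec)
    (hO : O.SoloProgress) {c c' : (ASpec S hS n).Config} {d : O.Config} {x : Label M A B n}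
    (h : SimRel S O hS c d) (hx : (ASpec S hS n).Trans c x c') :
    ∃ lab d', O.sem.Run d lab d' ∧ history lab = history [x] ∧ SimRel S O hS c' d' := by
  obtain ⟨L, ops, hI, hd, hl⟩ := h
  cases hx with
  | call p m a hp =>
    have hlp := hl p
    rw [hp] at hlp
    obtain ⟨hdp, hmem⟩ : d.proc p = ProcState.idle ∧ Mem.announce c.mem p ∈ L := by
      rcases hlp with ⟨-, h⟩ | ⟨_, _, hs, -⟩ | ⟨_, _, hs, -⟩
      · exact h
      · cases hs
      · cases hs
    refine ⟨_, _, .single (.call d p m a hdp), rfl, L, ops, hI, hd, fun q => ?_⟩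
    by_cases hq : q = p
    · subst hq
      simp only [Function.update_self]
      exact .inr (.inl ⟨m, a, rfl, rfl, hmem⟩)
    · simp only [Function.update_of_ne hq]
      exact hl q
  | ret p m l b hp hres =>
    have hlp := hl p
    rw [hp] at hlp
    cases l with
    | done b' =>
      cases hres
      rcases hlp.of_busy with ⟨_, h, -⟩ | ⟨-, ⟨i, o, hi, ho, hb⟩, he⟩
      · cases h
      · have hmem := List.mem_of_getElem? hi
        rcases he with ⟨hn, -⟩ | ⟨j, o', k, hj, ho', hdp, hk⟩
        · exact absurd hmem hn
        · obtain rfl : i = j := by simpa using hI.index_unique hi hj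
          rw [ho] at ho'
          cases ho'
          rw [hb] at hk
          refine ⟨_, _, .single (.ret d p m k b hdp hk), rfl, L, ops, hI, hd, fun q => ?_⟩
          by_cases hq : q = p
          · subst hq
            simp only [Function.update_self]
            exact .inl ⟨rfl, rfl, hmem⟩
          · simp only [Function.update_of_ne hq]
            exact hl q
    | _ => cases hres
  | internal p m l l' μ' hp hres hs =>
    have hlp := hl p
    rw [hp] at hlp
    rcases step_cases hdet hI (hd.mem_spec hlin) hlp.regInv hs with
      ⟨m', a, rfl, rfl, rfl⟩ | ⟨w, y, rfl, hf, hw, rfl⟩ | ⟨hns, hI', hE, hann, hreg⟩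
    · rcases hlp.of_busy with ⟨a', hst, hdp, hmem⟩ | ⟨hns, -⟩
      swap
      · exact absurd rfl (hns _ _)
      cases hst
      obtain ⟨hI', hE⟩ := hI.alloc hmem m a
      refine ⟨[], d, .nil _, rfl, L, ops, hI', hd, fun q => ?_⟩
      by_cases hq : q = p
      · subst hq
        simp only [Function.update_self]
        have hsize : (Mem.alloc c.mem q m a).announce q = Mem.size c.mem :=
          Function.update_self ..
        refine .inr (.inr ⟨m, _, rfl, by simp, trivial, .inl ⟨?_, a, ?_, hdp⟩⟩)
        · rw [hsize]
          exact fun hm => (hI.lt_size _ hm).false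
        · rw [hsize]
          simp [Mem.alloc, newNode]
      · simp only [Function.update_of_ne hq]
        exact (hl q).mono hI hE hq id
    · rcases hlp.of_busy with ⟨a', rfl, -⟩ | ⟨hns, -⟩
      · simp [ASpec, step] at hs
      · exact sim_decide hO hI hd hl hp hns hf hw
    · refine ⟨[], d, .nil _, rfl, L, ops, hI', hd, fun q => ?_⟩
      by_cases hq : q = p
      · subst hq
        simp only [Function.update_self]
        rcases hlp.of_busy with ⟨a', rfl, -, hmem⟩ | ⟨-, -, he⟩
        · exfalso
          -- An announcement would change `announce`, which is unchanged in this case.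
          have : Mem.announce μ' q = Mem.size c.mem := by
            rw [hs.2]; simp
          rw [hann] at this
          exact (hI.announce_lt q).ne this
        · exact .inr (.inr ⟨m, l', rfl, hns, hreg, he.mono hI hE (congrFun hann q) id⟩)
      · simp only [Function.update_of_ne hq]
        exact (hl q).mono hI hE hq id

/-- The universal construction is simulated by every linearizable object in which operations
that run alone terminate. -/
theorem forwardSimulated (hdet : S.Deterministic) (hS : S.NonBlocking)
    (hlin : O.LinearizableWrt S.spec) (hO : O.SoloProgress) :
    ForwardSimulated (ASpec S hS n).sem O.sem :=
  ⟨SimRel S O hS, simRel_init hS, fun _ _ _ _ h hx => sim_step hdet hlin hO h hx⟩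

end Universal

theorem lemma4 {M A B : Type*} (S : SeqLTS M A B) (hdet : S.Deterministic)
    (hnb : S.NonBlocking) (n : ℕ) (O : ConcObj M A B n) (hlin : O.LinearizableWrt S.spec) :
    (O.WaitFree → ForwardSimulated (ASpec S hnb n).sem O.sem) ∧
    (O.LockFree → ForwardSimulated (ASpec S hnb n).sem O.sem) ∧
    (O.ObstructionFree → ForwardSimulated (ASpec S hnb n).sem O.sem) :=
  ⟨fun h => Universal.forwardSimulated hdet hnb hlin h.soloProgress,
    fun h => Universal.forwardSimulated hdet hnb hlin h.soloProgress,
    fun h => Universal.forwardSimulated hdet hnb hlin h.soloProgress⟩
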